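/- **Definitions.** For $s\ge 1$ let $\mathrm{Li}_s(z)=\sum_{k\ge1}z^k/k^s$. A power series $V\in\mathbb Q[[z]]$ without constant term is a *2-function* if $V=\sum_{d\ge1}n_d\,\mathrm{Li}_2(z^d)$ with all $n_d\in\mathbb Z$; it is a *2-function at the prime $p$* if $V=\sum_{d\ge1}n_d\,\mathrm{Li}_2(z^d)$ with rational $n_d$ whose denominators are all prime to $p$. Let $\delta_q=q\,\frac{d}{dq}$. For a commutative ring $A$ let $K_2^0(A)=(A^\times\otimes_{\mathbb Z}A^\times)/J$, where $J$ is the subgroup generated by all $f\otimes(1-f)$ with $f,\,1-f\in A^\times$; it is written additively, and $\{f,g\}$ denotes the class of $f\otimes g$. Two units $f,g$ of $A=\mathbb Z((q))$ are *orthogonal*, $f\perp g$, if there are sequences of units $f_n\to f$, $g_n\to g$ (for the topology on $A^\times$ induced by the $q$-adic topology of $A$) with $2\{f_n,g_n\}=0$ in $K_2^0(A)$ for every $n$. **Theorem.** (1) Let $W\in\mathbb Q[[q]]$ have zero constant term, and suppose that $Y(q)=\exp(-\delta_qW(q))$ is an invertible element of $\mathbb Z((q))$. If $Y\perp q$, then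 $W$ is a 2-function at every odd prime. (2) Let $Y\in 1+q\,\mathbb Z[[q]]$, let $m\in\mathbb Z$, and let $V=\int\log(Y)\,d\log q\in q\,\mathbb Q[[q]]$. If $q\perp q^mY$, then $V$ is a 2-function at every odd prime. Conversely, if $V$ is a 2-function, then $q\perp q^mY$. In particular, if $V$ is a 2-function at the prime $2$, then $q\perp q^mY$ if and only if $V$ is a 2-function at every odd prime. -/

import Mathlib

open scoped TensorProduct PowerSeries LaurentSeries

noncomputable section

namespace TwoFunctions

/-! ### Polylogarithms and `s`-functions -/

/-- The formal `s`-logarithm `Li_s(z) = ∑_{k ≥ 1} z ^ k / k ^ s`. -/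
def polylog (s : ℕ) : ℚ⟦X⟧ :=
  PowerSeries.mk fun k => if k = 0 then 0 else 1 / (k : ℚ) ^ s

/-- `V = ∑_{d ≥ 1} n d • Li_s(z ^ d)` as formal power series, where the values `n d`, `d ≥ 1`, are
the coefficients. Since `Li_s(z ^ d)` starts in degree `d`, only the terms with `1 ≤ d ≤ k`
contribute to the coefficient of `z ^ k`; the summation variable below is `d - 1`. -/
def IsPolylogSum (s : ℕ) (n : ℕ → ℚ) (V : ℚ⟦X⟧) : Prop :=
  ∀ k : ℕ, PowerSeries.coeff k V =
    ∑ i ∈ Finset.range k,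
      n (i + 1) * PowerSeries.coeff k (PowerSeries.expand (i + 1) i.succ_ne_zero (polylog s))

/-- `V` is an `s`-function: an integral linear combination of the `Li_s(z ^ d)`, `d ≥ 1`. -/
def IsSFunction (s : ℕ) (V : ℚ⟦X⟧) : Prop :=
  ∃ n : ℕ → ℤ, IsPolylogSum s (fun d => (n d : ℚ)) V

/-- `V` is an `s`-function with respect to the prime `p`: a linear combination of the
`Li_s(z ^ d)`, `d ≥ 1`, whose coefficients are `p`-integral rational numbers. -/
def IsSFunctionAt (p s : ℕ) (V : ℚ⟦X⟧) : Prop :=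
  ∃ n : ℕ → ℚ, (∀ d, ¬ p ∣ (n d).den) ∧ IsPolylogSum s n V

/-- The logarithmic derivative `δ = z d/dz` on formal power series. -/
def logDerivOp (V : ℚ⟦X⟧) : ℚ⟦X⟧ :=
  PowerSeries.X * PowerSeries.derivative ℚ V

/-- The formal power series `exp (-δ W)`. The series `-δ W` has no constant term, so that it may be
substituted into the exponential series. -/
def expNegLogDeriv (W : ℚ⟦X⟧) : ℚ⟦X⟧ :=
  (PowerSeries.exp ℚ).subst (-logDerivOp W)

/-- The formal integral `∫ h dlog z`, for a power series `h` without constant term, normalised to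
have no constant term: `z ^ k` is sent to `z ^ k / k` for `k ≥ 1`. -/
def dlogIntegral (h : ℚ⟦X⟧) : ℚ⟦X⟧ :=
  PowerSeries.mk fun k => if k = 0 then 0 else PowerSeries.coeff k h / (k : ℚ)

/-! ### The group `K₂⁰(A) = (Aˣ ⊗ Aˣ) / J` and orthogonality -/

section KTheory

variable (A : Type*) [CommRing A]

/-- The subgroup `J` of `Aˣ ⊗ Aˣ` generated by the elements `f ⊗ (1 - f)`, with `f` and `1 - f`
invertible. -/
def steinbergSubgroup : Submodule ℤ (Additive Aˣ ⊗[ℤ] Additive Aˣ) :=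
  Submodule.span ℤ
    {x | ∃ f g : Aˣ, (g : A) = 1 - (f : A) ∧ x = Additive.ofMul f ⊗ₜ[ℤ] Additive.ofMul g}

/-- The (additively written) group `K₂⁰(A) = (Aˣ ⊗ Aˣ) / J`. -/
abbrev K20 : Type _ :=
  (Additive Aˣ ⊗[ℤ] Additive Aˣ) ⧸ steinbergSubgroup A

variable {A}

/-- The symbol `{f, g}` in `K₂⁰(A)`. -/
def symbol (f g : Aˣ) : K20 A :=
  (steinbergSubgroup A).mkQ (Additive.ofMul f ⊗ₜ[ℤ] Additive.ofMul g)

/-- `f` and `g` are orthogonal (in the purely algebraic sense) if `2 {f, g} = 0`. -/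
def AlgOrthogonal (f g : Aˣ) : Prop :=
  (2 : ℤ) • symbol f g = 0

end KTheory

/-! ### The `q`-adic topology on `ℤ((q))` and topological orthogonality -/

/-- The `q`-adic topology on the ring `R((q))`: the sets `f + q ^ N R[[q]]`, `N : ℤ`, form a basis
of the neighbourhoods of `f`. -/
@[reducible] def qAdicTopology (R : Type*) [CommRing R] : TopologicalSpace R⸨X⸩ where
  IsOpen U := ∀ f ∈ U, ∃ N : ℤ, ∀ g : R⸨X⸩,
    (∀ k : ℤ, k < N → (g - f).coeff k = 0) → g ∈ U
  isOpen_univ := fun _ _ => ⟨0, fun _ _ => trivial⟩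
  isOpen_inter := by
    intro U V hU hV f hf
    obtain ⟨M, hM⟩ := hU f hf.1
    obtain ⟨N, hN⟩ := hV f hf.2
    exact ⟨max M N, fun g hg =>
      ⟨hM g fun k hk => hg k (lt_of_lt_of_le hk (le_max_left _ _)),
        hN g fun k hk => hg k (lt_of_lt_of_le hk (le_max_right _ _))⟩⟩
  isOpen_sUnion := by
    intro S hS f hf
    obtain ⟨U, hU, hfU⟩ := hf
    obtain ⟨N, hN⟩ := hS U hU f hfU
    exact ⟨N, fun g hg => ⟨U, hU, hN g hg⟩⟩

/-- The topology on the unit group of `R((q))` induced by the `q`-adic topology. -/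
@[reducible] def qAdicUnitsTopology (R : Type*) [CommRing R] : TopologicalSpace (R⸨X⸩)ˣ :=
  TopologicalSpace.induced Units.val (qAdicTopology R)

/-- `f` and `g` are orthogonal in the topological sense: there is a sequence of pairs `(fₙ, gₙ)` of
units with `fₙ → f`, `gₙ → g` and `2 {fₙ, gₙ} = 0` in `K₂⁰(ℤ((q)))` for all `n`. -/
def Orthogonal (f g : (ℤ⸨X⸩)ˣ) : Prop :=
  ∃ F G : ℕ → (ℤ⸨X⸩)ˣ,
    Filter.Tendsto F Filter.atTop (@nhds _ (qAdicUnitsTopology ℤ) f) ∧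
    Filter.Tendsto G Filter.atTop (@nhds _ (qAdicUnitsTopology ℤ) g) ∧
    ∀ n, AlgOrthogonal (F n) (G n)

/-- The variable `q`, as a unit of `ℤ((q))`. -/
def qUnit : (ℤ⸨X⸩)ˣ where
  val := HahnSeries.single 1 1
  inv := HahnSeries.single (-1) 1
  val_inv := by simp
  inv_val := by simp

end TwoFunctions

end

open scoped TensorProduct PowerSeries LaurentSeries

noncomputable section

namespace TwoFunctions

open PowerSeries

/-! Fix an odd prime p and let φ be q ↦ q^p. For a unit f = q^m u of ℤ((q)) put ℓ(f) = log u
(constant term dropped), L(f) = ℓ(f) - p⁻¹ φℓ(f) and D(f) = δf/f. Then L(f) is p-integral, since u^p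
≡ φ(u) mod p. The `regulator` r(f,g) = L(f) φD(g) - D(f) L(g) is bilinear, and modulo δ of
p-integral series it kills every f ⊗ (1 - f): by `dilog_primitive_mem`, a p-adic dilogarithm of f is
an integral primitive (`regulator_one_sub_mem`). As 2 is invertible at p, 2{f,g} = 0 forces r(f,g)
to be exact. Exactness is tested on single coefficients, so it survives q-adic limits
(`regulator_mem_of_orthogonal`).

Since L(q) = 0 and D(q) = 1, r(f,q) = L(f). If ℓ(f) = ±δV, exactness of L(f) says that V - p⁻² φV is
p-integral, which implies that V is a 2-function at p (`isSFunctionAt_of_sub_frob_mem`).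

Conversely, V = ∑ n_d Li_2(q^d) gives exp(δV) = ∏ (1 - q^d)^(-d n_d). The symbol d{q, 1 - q^d} =
{q^d, 1 - q^d} vanishes and 2{q,q} = 0, so q^m times each finite product is orthogonal to q, and
these converge (`orthogonal_of_isSFunction`). -/

/-! ### `p`-integral rational numbers and power series -/

/-- The ring of `p`-integral rational numbers. -/
def pIntegers (p : ℕ) [Fact p.Prime] : Subring ℚ :=
  (Rat.padicValuation p).integer

/-- The ring of power series with `p`-integral coefficients. -/
def pIntegralSeries (p : ℕ) [Fact p.Prime] : Subring ℚ⟦X⟧ :=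
  (PowerSeries.map (pIntegers p).subtype).range

section Integrality

variable {p : ℕ} [hp : Fact p.Prime]

theorem mem_pIntegers {x : ℚ} : x ∈ pIntegers p ↔ ¬ p ∣ x.den :=
  Rat.padicValuation_le_one_iff

theorem intCast_mem_pIntegers (n : ℤ) : (n : ℚ) ∈ pIntegers p := intCast_mem _ n

theorem natCast_mem_pIntegers (n : ℕ) : (n : ℚ) ∈ pIntegers p := natCast_mem _ n

theorem inv_natCast_mem_pIntegers {n : ℕ} (hn : ¬ p ∣ n) : (n : ℚ)⁻¹ ∈ pIntegers p := by
  have h0 : n ≠ 0 := by rintro rfl; exact hn (dvd_zero p)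
  rw [mem_pIntegers, Rat.inv_natCast_den_of_pos (Nat.pos_of_ne_zero h0)]
  exact hn

theorem pow_div_mem_pIntegers {n a : ℕ} (hn : n ≠ 0) (h : padicValNat p n ≤ a) :
    (p : ℚ) ^ a / n ∈ pIntegers p := by
  obtain ⟨m, c, hc, rfl⟩ := Nat.exists_eq_pow_mul_and_not_dvd hn p hp.out.ne_one
  have hcq : (c : ℚ) ≠ 0 := by
    rintro h0
    exact hc (Nat.cast_eq_zero.1 h0 ▸ dvd_zero p)
  have hpq : (p : ℚ) ≠ 0 := Nat.cast_ne_zero.2 hp.out.ne_zero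
  obtain ⟨b, rfl⟩ := Nat.exists_eq_add_of_le
    (((padicValNat_dvd_iff_le hn).1 (Dvd.intro c rfl) : m ≤ _).trans h)
  have : (p : ℚ) ^ (m + b) / (p ^ m * c : ℕ) = p ^ b * (c : ℚ)⁻¹ := by
    push_cast
    rw [pow_add]
    field_simp
  rw [this]
  exact mul_mem (pow_mem (natCast_mem_pIntegers p) _) (inv_natCast_mem_pIntegers hc)

/-- From p^v ≤ n + 1 and v < p^v one gets v ≤ n. These are the coefficients of p⁻¹ log(1 + px). -/
theorem pow_div_succ_mem_pIntegers (n : ℕ) : (p : ℚ) ^ n / ((n + 1 : ℕ) : ℚ) ∈ pIntegers p := by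
  refine pow_div_mem_pIntegers n.succ_ne_zero ?_
  have h1 : p ^ padicValNat p (n + 1) ≤ n + 1 := Nat.le_of_dvd n.succ_pos pow_padicValNat_dvd
  have h2 := Nat.lt_pow_self (n := padicValNat p (n + 1)) hp.out.one_lt
  omega

/-- Legendre's bound (p - 1) v < n + 2 with p - 1 ≥ 2 gives v ≤ n. For p = 2 this already fails at n
= 0. -/
theorem pow_div_factorial_mem_pIntegers (h2 : p ≠ 2) (n : ℕ) :
    (p : ℚ) ^ n / ((n + 2).factorial : ℚ) ∈ pIntegers p := by
  refine pow_div_mem_pIntegers (Nat.factorial_ne_zero _) ?_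
  have h := sub_one_mul_padicValNat_factorial_lt_of_ne_zero (p := p) (n := n + 2) (by omega)
  have h3 : 2 ≤ p - 1 := by have := hp.out.two_le; omega
  have := Nat.mul_le_mul_right (padicValNat p (n + 2).factorial) h3
  omega

theorem mem_pIntegralSeries {f : ℚ⟦X⟧} :
    f ∈ pIntegralSeries p ↔ ∀ n, coeff n f ∈ pIntegers p := by
  constructor
  · rintro ⟨g, rfl⟩ n
    rw [coeff_map]
    exact (coeff n g).2
  · intro h
    exact ⟨PowerSeries.mk fun n => ⟨coeff n f, h n⟩, by ext; simp⟩

theorem map_mem_pIntegralSeries (f : ℤ⟦X⟧) :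
    PowerSeries.map (Int.castRingHom ℚ) f ∈ pIntegralSeries p := by
  rw [mem_pIntegralSeries]
  intro n
  simp

theorem C_mem_pIntegralSeries {a : ℚ} (ha : a ∈ pIntegers p) :
    (C a : ℚ⟦X⟧) ∈ pIntegralSeries p :=
  ⟨C ⟨a, ha⟩, by simp⟩

theorem expand_mem_pIntegralSeries {f : ℚ⟦X⟧} (hf : f ∈ pIntegralSeries p) {k : ℕ} (hk : k ≠ 0) :
    expand k hk f ∈ pIntegralSeries p := by
  obtain ⟨g, rfl⟩ := hf
  exact ⟨expand k hk g, by simp⟩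

theorem hasSubst_of_constantCoeff_eq_zero {a : ℚ⟦X⟧} (ha : constantCoeff a = 0) : HasSubst a :=
  HasSubst.of_constantCoeff_zero' ha

theorem coeff_subst_eq_sum {a : ℚ⟦X⟧} (ha : constantCoeff a = 0) (f : ℚ⟦X⟧) {n N : ℕ}
    (h : n < N) : coeff n (f.subst a) = ∑ d ∈ Finset.range N, coeff d f * coeff n (a ^ d) := by
  rw [coeff_subst' (hasSubst_of_constantCoeff_eq_zero ha)]
  rw [finsum_eq_sum_of_support_subset (s := Finset.range N)]
  · simp only [smul_eq_mul]
  · intro d hd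
    simp only [Finset.coe_range, Set.mem_Iio]
    by_contra hdN
    apply hd
    have : X ^ d ∣ a ^ d := pow_dvd_pow_of_dvd (X_dvd_iff.2 ha) d
    simp only
    rw [X_pow_dvd_iff.1 this n (by omega), smul_zero]

theorem subst_mem_pIntegralSeries {f a : ℚ⟦X⟧} (hf : f ∈ pIntegralSeries p)
    (ha : a ∈ pIntegralSeries p) (ha0 : constantCoeff a = 0) :
    f.subst a ∈ pIntegralSeries p := by
  rw [mem_pIntegralSeries]
  intro n
  rw [coeff_subst_eq_sum ha0 f n.lt_succ_self]
  exact sum_mem fun d _ => mul_mem (mem_pIntegralSeries.1 hf d)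
    (mem_pIntegralSeries.1 (pow_mem ha d) n)

end Integrality

/-! ### The logarithmic derivative and the Frobenius lift -/

theorem coeff_logDerivOp (f : ℚ⟦X⟧) (n : ℕ) : coeff n (logDerivOp f) = n * coeff n f := by
  cases n with
  | zero => simp [logDerivOp]
  | succ n => rw [logDerivOp, coeff_succ_X_mul, coeff_derivative]; push_cast; ring

@[simp] theorem constantCoeff_logDerivOp (f : ℚ⟦X⟧) : constantCoeff (logDerivOp f) = 0 := by
  simp [logDerivOp]

theorem logDerivOp_add (f g : ℚ⟦X⟧) : logDerivOp (f + g) = logDerivOp f + logDerivOp g := by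
  simp [logDerivOp, mul_add]

theorem logDerivOp_sub (f g : ℚ⟦X⟧) : logDerivOp (f - g) = logDerivOp f - logDerivOp g := by
  simp [logDerivOp, mul_sub]

theorem logDerivOp_neg (f : ℚ⟦X⟧) : logDerivOp (-f) = -logDerivOp f := by
  simp [logDerivOp]

theorem logDerivOp_mul (f g : ℚ⟦X⟧) :
    logDerivOp (f * g) = logDerivOp f * g + f * logDerivOp g := by
  simp [logDerivOp]; ring

@[simp] theorem logDerivOp_C (a : ℚ) : logDerivOp (C a) = 0 := by
  simp [logDerivOp]

theorem logDerivOp_C_mul (a : ℚ) (f : ℚ⟦X⟧) : logDerivOp (C a * f) = C a * logDerivOp f := by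
  rw [logDerivOp_mul, logDerivOp_C, zero_mul, zero_add]

theorem logDerivOp_expand (f : ℚ⟦X⟧) {k : ℕ} (hk : k ≠ 0) :
    logDerivOp (expand k hk f) = C (k : ℚ) * expand k hk (logDerivOp f) := by
  ext n
  rw [coeff_logDerivOp, coeff_C_mul, coeff_expand, coeff_expand]
  split_ifs with h
  · obtain ⟨m, rfl⟩ := h
    rw [Nat.mul_div_cancel_left _ (Nat.pos_of_ne_zero hk), coeff_logDerivOp]
    push_cast; ring
  · simp

theorem logDerivOp_subst (f : ℚ⟦X⟧) {a : ℚ⟦X⟧} (ha : constantCoeff a = 0) :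
    logDerivOp (f.subst a) = (derivative ℚ f).subst a * logDerivOp a := by
  rw [logDerivOp, derivative_subst (hasSubst_of_constantCoeff_eq_zero ha), logDerivOp]; ring

theorem logDerivOp_injective {f g : ℚ⟦X⟧} (h0 : constantCoeff f = constantCoeff g)
    (h : logDerivOp f = logDerivOp g) : f = g := by
  ext n
  rcases Nat.eq_zero_or_pos n with rfl | hn
  · simpa using h0
  · have := congrArg (coeff n) h
    rw [coeff_logDerivOp, coeff_logDerivOp] at this
    exact mul_left_cancel₀ (by exact_mod_cast hn.ne') this

@[simp] theorem constantCoeff_dlogIntegral (h : ℚ⟦X⟧) : constantCoeff (dlogIntegral h) = 0 := by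
  rw [← coeff_zero_eq_constantCoeff_apply, dlogIntegral]; simp

theorem logDerivOp_dlogIntegral {h : ℚ⟦X⟧} (h0 : constantCoeff h = 0) :
    logDerivOp (dlogIntegral h) = h := by
  ext n
  rw [coeff_logDerivOp, dlogIntegral, coeff_mk]
  split_ifs with hn
  · subst hn; simpa using h0.symm
  · have : (n : ℚ) ≠ 0 := by exact_mod_cast hn
    field_simp

/-- Two solutions of the same first order equation with the same nonzero initial value agree. -/
theorem eq_of_logDerivOp_eq_mul {a b c : ℚ⟦X⟧} (ha : logDerivOp a = c * a)
    (hb : logDerivOp b = c * b) (h0 : constantCoeff a = constantCoeff b)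
    (hb0 : constantCoeff b ≠ 0) : a = b := by
  have hbb : b * b⁻¹ = 1 := PowerSeries.mul_inv_cancel b hb0
  have hb' : logDerivOp (b⁻¹) = - c * b⁻¹ := by
    have h1 : logDerivOp (b * b⁻¹) = 0 := by rw [hbb, ← map_one C, logDerivOp_C]
    rw [logDerivOp_mul, hb] at h1
    linear_combination b⁻¹ * h1 + (-c * b⁻¹ - logDerivOp b⁻¹) * hbb
  have h2 : a * b⁻¹ = 1 := by
    apply logDerivOp_injective
    · rw [map_mul, constantCoeff_inv, h0, mul_inv_cancel₀ hb0, map_one]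
    · rw [logDerivOp_mul, ha, hb', ← map_one C, logDerivOp_C]; ring
  linear_combination b * h2 - a * hbb

/-! ### Logarithms characterised by the equation δu = δ(log u) · u -/

/-- The logarithm of a power series `u` with nonzero constant term, normalised to have no constant
term. -/
def seriesLog (u : ℚ⟦X⟧) : ℚ⟦X⟧ := dlogIntegral (logDerivOp u * u⁻¹)

@[simp] theorem constantCoeff_seriesLog (u : ℚ⟦X⟧) : constantCoeff (seriesLog u) = 0 :=
  constantCoeff_dlogIntegral _

theorem logDerivOp_seriesLog_mul {u : ℚ⟦X⟧} (hu : constantCoeff u ≠ 0) :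
    logDerivOp u = logDerivOp (seriesLog u) * u := by
  rw [seriesLog, logDerivOp_dlogIntegral (by simp), mul_assoc, PowerSeries.inv_mul_cancel u hu,
    mul_one]

/-- A series without constant term is determined by its δ. The logarithm identities below are proved
by checking this differential equation. -/
theorem eq_seriesLog {u l : ℚ⟦X⟧} (hu : constantCoeff u ≠ 0) (hl : constantCoeff l = 0)
    (h : logDerivOp u = logDerivOp l * u) : l = seriesLog u := by
  apply logDerivOp_injective
  · simp [hl]
  · rw [seriesLog, logDerivOp_dlogIntegral (by simp), h, mul_assoc, PowerSeries.mul_inv_cancel u hu,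
      mul_one]

theorem seriesLog_mul {u v : ℚ⟦X⟧} (hu : constantCoeff u ≠ 0) (hv : constantCoeff v ≠ 0) :
    seriesLog (u * v) = seriesLog u + seriesLog v := by
  symm
  apply eq_seriesLog
  · simp [hu, hv]
  · simp
  · rw [logDerivOp_mul, logDerivOp_add]
    linear_combination v * logDerivOp_seriesLog_mul hu + u * logDerivOp_seriesLog_mul hv

theorem logDerivOp_subst_exp {l : ℚ⟦X⟧} (hl : constantCoeff l = 0) :
    logDerivOp ((exp ℚ).subst l) = logDerivOp l * (exp ℚ).subst l := by
  rw [logDerivOp_subst _ hl, derivative_exp, mul_comm]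

theorem constantCoeff_subst_of_constantCoeff_eq_zero (f : ℚ⟦X⟧) {a : ℚ⟦X⟧}
    (ha : constantCoeff a = 0) : constantCoeff (f.subst a) = constantCoeff f := by
  rw [← coeff_zero_eq_constantCoeff_apply, coeff_subst_eq_sum ha f (Nat.zero_lt_one)]
  simp

theorem seriesLog_subst_exp {l : ℚ⟦X⟧} (hl : constantCoeff l = 0) :
    seriesLog ((exp ℚ).subst l) = l :=
  (eq_seriesLog (by rw [constantCoeff_subst_of_constantCoeff_eq_zero _ hl]; simp) hl
    (logDerivOp_subst_exp hl)).symm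

theorem one_add_mul_derivative_log : (1 + X : ℚ⟦X⟧) * derivative ℚ (log ℚ) = 1 := by
  rw [deriv_log]
  ext n
  rw [add_mul, one_mul, map_add]
  cases n with
  | zero => simp
  | succ n => simp [coeff_succ_X_mul, pow_succ, coeff_one]

theorem logOf_eq_seriesLog {u : ℚ⟦X⟧} (hu : constantCoeff u = 1) : logOf u = seriesLog u := by
  have h0 : constantCoeff (u - 1) = 0 := by simp [hu]
  apply eq_seriesLog (by simp [hu]) (constantCoeff_logOf hu)
  have h1 := congrArg (PowerSeries.subst (u - 1)) one_add_mul_derivative_log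
  have hs := hasSubst_of_constantCoeff_eq_zero h0
  have hone : (1 : ℚ⟦X⟧).subst (u - 1) = (1 : ℚ⟦X⟧) := by
    rw [← coe_substAlgHom hs, map_one]
  rw [subst_mul hs, subst_add hs, subst_X hs, hone, add_sub_cancel] at h1
  have hd : logDerivOp (u - 1) = logDerivOp u := by
    rw [logDerivOp_sub, ← map_one C, logDerivOp_C, sub_zero]
  rw [logOf, logDerivOp_subst _ h0, hd]
  linear_combination (-logDerivOp u) * h1

/-! ### The Frobenius-twisted logarithm -/

section Frobenius

variable (p : ℕ) [hp : Fact p.Prime]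

/-- The Frobenius lift `q ↦ q ^ p` on power series. -/
abbrev frob : ℚ⟦X⟧ →ₐ[ℚ] ℚ⟦X⟧ := expand p hp.out.ne_zero

/-- The operator `l ↦ l - p⁻¹ l(q ^ p)`. -/
def frobLog : ℚ⟦X⟧ →ₗ[ℚ] ℚ⟦X⟧ := LinearMap.id - (p : ℚ)⁻¹ • (frob p).toLinearMap

theorem frobLog_apply (l : ℚ⟦X⟧) : frobLog p l = l - C (p : ℚ)⁻¹ * frob p l := by
  simp [frobLog, smul_eq_C_mul]

@[simp] theorem constantCoeff_frobLog {l : ℚ⟦X⟧} (hl : constantCoeff l = 0) :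
    constantCoeff (frobLog p l) = 0 := by
  simp [frobLog_apply, hl]

variable {p}

theorem C_mul_C_inv_prime : (C (p : ℚ) * C (p : ℚ)⁻¹ : ℚ⟦X⟧) = 1 := by
  rw [← map_mul, mul_inv_cancel₀ (Nat.cast_ne_zero.2 hp.out.ne_zero), map_one]

theorem logDerivOp_frob (f : ℚ⟦X⟧) : logDerivOp (frob p f) = C (p : ℚ) * frob p (logDerivOp f) :=
  logDerivOp_expand f _

theorem logDerivOp_frobLog (l : ℚ⟦X⟧) :
    logDerivOp (frobLog p l) = logDerivOp l - frob p (logDerivOp l) := by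
  rw [frobLog_apply, logDerivOp_sub, logDerivOp_C_mul, logDerivOp_frob]
  linear_combination (- frob p (logDerivOp l)) * C_mul_C_inv_prime (p := p)

/-! ### Frobenius congruences and integrality of the twisted logarithm -/

/-- Modulo p, the p-th power map is q ↦ q^p, because Frobenius is trivial on the coefficient field
`ZMod p`. -/
theorem dvd_coeff_pow_sub_expand (u : ℤ⟦X⟧) (n : ℕ) :
    (p : ℤ) ∣ coeff n (u ^ p - expand p hp.out.ne_zero u) := by
  have h : PowerSeries.map (Int.castRingHom (ZMod p)) (u ^ p - expand p hp.out.ne_zero u) = 0 := by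
    have h1 := MvPowerSeries.map_frobenius_expand (R := ZMod p) p hp.out.ne_zero
      (f := PowerSeries.map (Int.castRingHom (ZMod p)) u)
    rw [ZMod.frobenius_zmod] at h1
    rw [map_sub, map_pow, map_expand, sub_eq_zero]
    refine h1.symm.trans ?_
    ext n
    exact MvPowerSeries.coeff_map _ _ _
  have h2 := congrArg (coeff n) h
  rw [coeff_map] at h2
  exact (ZMod.intCast_zmod_eq_zero_iff_dvd _ _).1 (by simpa using h2)

@[simp] theorem constantCoeff_map_intCast (u : ℤ⟦X⟧) :
    constantCoeff (PowerSeries.map (Int.castRingHom ℚ) u) = (constantCoeff u : ℤ) := by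
  rw [← coeff_zero_eq_constantCoeff_apply, coeff_map, coeff_zero_eq_constantCoeff_apply]
  simp

theorem inv_prime_mul_log_mem (x : ℤ⟦X⟧) (hx : constantCoeff x = 0) :
    C (p : ℚ)⁻¹ * (log ℚ).subst (C (p : ℚ) * PowerSeries.map (Int.castRingHom ℚ) x) ∈
      pIntegralSeries p := by
  have hpq : (p : ℚ) ≠ 0 := Nat.cast_ne_zero.2 hp.out.ne_zero
  rw [mem_pIntegralSeries]
  intro n
  rw [coeff_C_mul, coeff_subst_eq_sum (by simp [hx]) _ n.lt_succ_self, Finset.mul_sum]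
  refine sum_mem fun d _ => ?_
  rw [coeff_log]
  rcases d with _ | d
  · simp
  · rw [if_neg d.succ_ne_zero, mul_pow, ← map_pow C, coeff_C_mul]
    have : (p : ℚ)⁻¹ * (algebraMap ℚ ℚ ((-1) ^ (d + 1 + 1) / (d + 1 : ℕ)) * ((p : ℚ) ^ (d + 1) *
        coeff n (PowerSeries.map (Int.castRingHom ℚ) x ^ (d + 1)))) =
        ((-1 : ℤ) ^ (d + 1 + 1) : ℤ) * ((p : ℚ) ^ d / ((d + 1 : ℕ) : ℚ)) *
          coeff n (PowerSeries.map (Int.castRingHom ℚ) x ^ (d + 1)) := by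
      simp only [Algebra.algebraMap_self, RingHom.id_apply]
      push_cast
      field_simp
      ring
    rw [this]
    exact mul_mem (mul_mem (intCast_mem_pIntegers _) (pow_div_succ_mem_pIntegers d))
      (mem_pIntegralSeries.1 (pow_mem (map_mem_pIntegralSeries x) _) n)

theorem constantCoeff_map_eq_one_or {u : ℤ⟦X⟧} (hu : IsUnit u) :
    constantCoeff (PowerSeries.map (Int.castRingHom ℚ) u) = 1 ∨
      constantCoeff (PowerSeries.map (Int.castRingHom ℚ) u) = -1 := by
  have h := Int.isUnit_iff.1 (isUnit_iff_constantCoeff.1 hu)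
  rcases h with h | h <;> simp [h]

theorem constantCoeff_map_ne_zero {u : ℤ⟦X⟧} (hu : IsUnit u) :
    constantCoeff (PowerSeries.map (Int.castRingHom ℚ) u) ≠ 0 := by
  rcases constantCoeff_map_eq_one_or hu with h | h <;> simp [h]

theorem logDerivOp_pow_of_eq_mul {u c : ℚ⟦X⟧} (h : logDerivOp u = c * u) (n : ℕ) :
    logDerivOp (u ^ n) = n * c * u ^ n := by
  induction n with
  | zero => rw [pow_zero, ← map_one C, logDerivOp_C]; simp
  | succ n ih => rw [pow_succ, logDerivOp_mul, ih, h]; push_cast; ring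

/-- Both sides solve the same first-order equation. The initial values agree because the constant
term is ±1 and p is odd. -/
theorem pow_eq_frob_pow_mul_exp (h2 : p ≠ 2) {u : ℤ⟦X⟧} (hu : IsUnit u) (n : ℕ) :
    PowerSeries.map (Int.castRingHom ℚ) u ^ (p * n) =
      frob p (PowerSeries.map (Int.castRingHom ℚ) u) ^ n *
        (exp ℚ).subst (C ((p * n : ℕ) : ℚ) *
          frobLog p (seriesLog (PowerSeries.map (Int.castRingHom ℚ) u))) := by
  have h0 := constantCoeff_map_ne_zero hu
  have hpm : constantCoeff (PowerSeries.map (Int.castRingHom ℚ) u) ^ p =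
      constantCoeff (PowerSeries.map (Int.castRingHom ℚ) u) := by
    rcases constantCoeff_map_eq_one_or hu with h | h
    · simp [h]
    · rw [h, (hp.out.odd_of_ne_two h2).neg_one_pow]
  generalize PowerSeries.map (Int.castRingHom ℚ) u = v at *
  have hl : constantCoeff (C ((p * n : ℕ) : ℚ) * frobLog p (seriesLog v)) = 0 := by
    rw [map_mul, constantCoeff_frobLog _ (by simp), mul_zero]
  have hδ := logDerivOp_seriesLog_mul h0
  have hcast : (C ((p * n : ℕ) : ℚ) : ℚ⟦X⟧) = ((p * n : ℕ) : ℚ⟦X⟧) := map_natCast _ _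
  have hCp : (C (p : ℚ) : ℚ⟦X⟧) = (p : ℚ⟦X⟧) := map_natCast _ _
  apply eq_of_logDerivOp_eq_mul (c := ((p * n : ℕ) : ℚ⟦X⟧) * logDerivOp (seriesLog v))
  · rw [logDerivOp_pow_of_eq_mul hδ]
  · have h3 : logDerivOp (frob p v) = (C (p : ℚ) * frob p (logDerivOp (seriesLog v))) * frob p v := by
      rw [logDerivOp_frob]
      conv_lhs => rw [hδ]
      rw [map_mul]; ring
    rw [logDerivOp_mul, logDerivOp_pow_of_eq_mul h3, logDerivOp_subst_exp hl, logDerivOp_C_mul,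
      logDerivOp_frobLog, hcast, hCp]
    push_cast
    ring
  · rw [map_pow, map_mul, map_pow, constantCoeff_expand,
      constantCoeff_subst_of_constantCoeff_eq_zero _ hl, pow_mul, hpm]
    simp
  · rw [map_mul, map_pow, constantCoeff_expand,
      constantCoeff_subst_of_constantCoeff_eq_zero _ hl]
    simp [h0]

theorem seriesLog_pow {u : ℚ⟦X⟧} (hu : constantCoeff u ≠ 0) (n : ℕ) :
    seriesLog (u ^ n) = C (n : ℚ) * seriesLog u := by
  symm
  apply eq_seriesLog
  · simp [hu]
  · simp
  · rw [logDerivOp_pow_of_eq_mul (logDerivOp_seriesLog_mul hu), logDerivOp_C_mul, map_natCast]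

theorem seriesLog_frob {u : ℚ⟦X⟧} (hu : constantCoeff u ≠ 0) :
    seriesLog (frob p u) = frob p (seriesLog u) := by
  symm
  apply eq_seriesLog
  · simp [hu]
  · simp
  · rw [logDerivOp_frob, logDerivOp_frob]
    conv_lhs => rw [logDerivOp_seriesLog_mul hu]
    rw [map_mul]; ring

/-- Write u^p = u(q^p) w with w ≡ 1 mod p; then the twisted logarithm is p⁻¹ log w. Oddness of p
makes the constant term of w equal to 1 even if that of u is -1. -/
theorem frobLog_seriesLog_mem (h2 : p ≠ 2) {u : ℤ⟦X⟧} (hu : IsUnit u) :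
    frobLog p (seriesLog (PowerSeries.map (Int.castRingHom ℚ) u)) ∈ pIntegralSeries p := by
  have hφ : IsUnit (expand p hp.out.ne_zero u) := hu.map _
  obtain ⟨w, hw⟩ : expand p hp.out.ne_zero u ∣ u ^ p := hφ.dvd
  obtain ⟨v, hv⟩ := hφ.exists_right_inv
  have hdvd : ∀ n, (p : ℤ) ∣ coeff n (w - 1) := by
    intro n
    have : w - 1 = v * (u ^ p - expand p hp.out.ne_zero u) := by
      linear_combination (-w + 1) * hv - v * hw
    rw [this, coeff_mul]
    exact Finset.dvd_sum fun i _ => (dvd_coeff_pow_sub_expand u _).mul_left _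
  choose x hx using hdvd
  have hwx : w = 1 + C (p : ℤ) * PowerSeries.mk x := by
    ext n
    have := hx n
    rw [map_sub] at this
    rw [map_add, coeff_C_mul, coeff_mk]
    linarith
  have hw1 : constantCoeff w = 1 := by
    have h := congrArg constantCoeff hw
    rw [map_pow, map_mul, constantCoeff_expand] at h
    rcases Int.isUnit_iff.1 (isUnit_iff_constantCoeff.1 hu) with h1 | h1 <;> rw [h1] at h
    · simpa using h.symm
    · rw [(hp.out.odd_of_ne_two h2).neg_one_pow] at h
      linarith
  have hx0 : constantCoeff (PowerSeries.mk x) = 0 := by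
    rw [hwx] at hw1
    simpa [hp.out.ne_zero] using hw1
  have hmap : PowerSeries.map (Int.castRingHom ℚ) u ^ p =
      frob p (PowerSeries.map (Int.castRingHom ℚ) u) * PowerSeries.map (Int.castRingHom ℚ) w := by
    rw [← map_pow, hw, map_mul, map_expand]
  have hu0 := constantCoeff_map_ne_zero hu
  have hw1' : constantCoeff (PowerSeries.map (Int.castRingHom ℚ) w) = 1 := by
    simp [hw1]
  have hlog := congrArg seriesLog hmap
  rw [seriesLog_pow hu0, seriesLog_mul (by rwa [constantCoeff_expand]) (by simp [hw1]), seriesLog_frob hu0,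
    ← logOf_eq_seriesLog hw1'] at hlog
  have hsub : PowerSeries.map (Int.castRingHom ℚ) w - 1 =
      C (p : ℚ) * PowerSeries.map (Int.castRingHom ℚ) (PowerSeries.mk x) := by
    rw [hwx]; simp
  have key : frobLog p (seriesLog (PowerSeries.map (Int.castRingHom ℚ) u)) =
      C (p : ℚ)⁻¹ * logOf (PowerSeries.map (Int.castRingHom ℚ) w) := by
    rw [frobLog_apply]
    linear_combination C (p : ℚ)⁻¹ * hlog -
      seriesLog (PowerSeries.map (Int.castRingHom ℚ) u) * C_mul_C_inv_prime (p := p)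
  rw [key, logOf, hsub]
  exact inv_prime_mul_log_mem _ hx0

/-! ### The `p`-adic dilogarithm -/

theorem coeff_polylog (s k : ℕ) : coeff k (polylog s) = if k = 0 then 0 else 1 / (k : ℚ) ^ s :=
  coeff_mk _ _

@[simp] theorem constantCoeff_polylog (s : ℕ) : constantCoeff (polylog s) = 0 := by
  rw [← coeff_zero_eq_constantCoeff_apply, coeff_polylog, if_pos rfl]

theorem logDerivOp_polylog_succ (s : ℕ) : logDerivOp (polylog (s + 1)) = polylog s := by
  ext k
  rw [coeff_logDerivOp, coeff_polylog, coeff_polylog]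
  split_ifs with h
  · simp
  · have : (k : ℚ) ≠ 0 := Nat.cast_ne_zero.2 h
    field_simp
    ring

theorem polylog_zero_eq : (1 - X) * polylog 0 = X := by
  ext n
  rw [sub_mul, one_mul, map_sub]
  rcases n with _ | _ | n <;> simp [coeff_succ_X_mul, coeff_polylog, coeff_X]

/-- `f ∘ a` is the sum of its leading terms, modulo a power of the variable. -/
theorem X_pow_dvd_subst_sub_sum {a : ℚ⟦X⟧} (ha : constantCoeff a = 0) (f : ℚ⟦X⟧) (N : ℕ) :
    X ^ N ∣ f.subst a - ∑ d ∈ Finset.range N, C (coeff d f) * a ^ d := by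
  rw [X_pow_dvd_iff]
  intro n hn
  rw [map_sub, coeff_subst_eq_sum ha f hn, map_sum]
  simp [coeff_C_mul]

theorem logDerivOp_polylog_succ_subst (s : ℕ) {F c : ℚ⟦X⟧} (hF : constantCoeff F = 0)
    (h : logDerivOp F = c * F) :
    logDerivOp ((polylog (s + 1)).subst F) = c * (polylog s).subst F := by
  have hs := hasSubst_of_constantCoeff_eq_zero hF
  rw [logDerivOp_subst _ hF, h, ← logDerivOp_polylog_succ s, logDerivOp, subst_mul hs, subst_X hs]
  ring

theorem seriesLog_one_sub {F : ℚ⟦X⟧} (hF : constantCoeff F = 0) :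
    seriesLog (1 - F) = -(polylog 1).subst F := by
  have hs := hasSubst_of_constantCoeff_eq_zero hF
  symm
  have hd : (1 - X) * derivative ℚ (polylog 1) = 1 := by
    have h1 := polylog_zero_eq
    rw [← logDerivOp_polylog_succ, logDerivOp] at h1
    exact mul_left_cancel₀ (a := (X : ℚ⟦X⟧)) X_ne_zero (by linear_combination h1)
  have h1 := congrArg (PowerSeries.subst F) hd
  have hone : (1 : ℚ⟦X⟧).subst F = (1 : ℚ⟦X⟧) := by
    rw [← coe_substAlgHom hs, map_one]
  rw [subst_mul hs, subst_sub hs, subst_X hs, hone] at h1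
  apply eq_seriesLog
  · simp [hF]
  · rw [map_neg, constantCoeff_subst_of_constantCoeff_eq_zero _ hF]; simp
  · rw [logDerivOp_neg, logDerivOp_subst _ hF, logDerivOp_sub, ← map_one C, logDerivOp_C, map_one]
    linear_combination logDerivOp F * h1

theorem expand_subst_eq {k : ℕ} (hk : k ≠ 0) (g : ℚ⟦X⟧) {F : ℚ⟦X⟧} (hF : constantCoeff F = 0) :
    expand k hk (g.subst F) = g.subst (expand k hk F) :=
  PowerSeries.expand_subst k hk (hasSubst_of_constantCoeff_eq_zero hF) g

theorem subst_expand {k : ℕ} (hk : k ≠ 0) (g : ℚ⟦X⟧) {F : ℚ⟦X⟧} (hF : constantCoeff F = 0) :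
    (expand k hk g).subst F = g.subst (F ^ k) := by
  have hs := hasSubst_of_constantCoeff_eq_zero hF
  rw [expand_apply, subst_comp_subst_apply (HasSubst.X_pow hk) hs, subst_pow hs, subst_X hs]

/-- The subtraction deletes exactly the terms with index divisible by p. -/
theorem polylog_sub_frob_mem :
    polylog 2 - C ((p : ℚ)⁻¹ ^ 2) * frob p (polylog 2) ∈ pIntegralSeries p := by
  rw [mem_pIntegralSeries]
  intro k
  rw [map_sub, coeff_C_mul, coeff_expand, coeff_polylog]
  have hpq : (p : ℚ) ≠ 0 := Nat.cast_ne_zero.2 hp.out.ne_zero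
  rcases Nat.eq_zero_or_pos k with rfl | hk
  · simp
  split_ifs with h1 h2 h2
  · omega
  · omega
  · obtain ⟨m, rfl⟩ := h2
    have hm : m ≠ 0 := by rintro rfl; simp at hk
    have hmq : (m : ℚ) ≠ 0 := Nat.cast_ne_zero.2 hm
    rw [Nat.mul_div_cancel_left _ hp.out.pos, coeff_polylog, if_neg hm]
    push_cast
    have : 1 / ((p : ℚ) * m) ^ 2 - (p : ℚ)⁻¹ ^ 2 * (1 / (m : ℚ) ^ 2) = 0 := by field_simp; ring
    rw [this]
    exact zero_mem _
  · rw [mul_zero, sub_zero, one_div, ← inv_pow]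
    exact pow_mem (inv_natCast_mem_pIntegers h2) 2

/-- The second order Taylor remainder of the exponential function. -/
theorem subst_exp_C_mul (c : ℚ) {L : ℚ⟦X⟧} (hL : constantCoeff L = 0) :
    (exp ℚ).subst (C c * L) = 1 + C c * L +
      C (c ^ 2) * (L ^ 2 * (PowerSeries.mk fun k => c ^ k / ((k + 2).factorial : ℚ)).subst L) := by
  have hs := hasSubst_of_constantCoeff_eq_zero hL
  have h1 : rescale c (exp ℚ) = C 1 + C c * X +
      C (c ^ 2) * (X ^ 2 * PowerSeries.mk fun k => c ^ k / ((k + 2).factorial : ℚ)) := by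
    ext n
    rcases n with _ | _ | n
    · simp
    · rw [map_add, map_add, coeff_C_mul (n := 1), coeff_C_mul, coeff_X_pow_mul']
      simp [coeff_exp]
    · rw [coeff_rescale, coeff_exp, map_add, map_add, coeff_C_mul, coeff_C_mul, coeff_X_pow_mul']
      simp [coeff_X]
      ring
  have h2 := congrArg (PowerSeries.subst L) h1
  have hsC : HasSubst (c • X : ℚ⟦X⟧) := HasSubst.smul_X' c
  have hC : ∀ a : ℚ, (C a : ℚ⟦X⟧).subst L = (C a : ℚ⟦X⟧) := fun a => subst_C a
  rw [rescale_eq_subst, subst_comp_subst_apply hsC hs, subst_smul hs, subst_X hs, subst_add hs,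
    subst_add hs, subst_mul hs, subst_mul hs, subst_mul hs, subst_pow hs, subst_X hs, hC, hC, hC,
    smul_eq_C_mul, map_one] at h2
  exact h2

/-- The factor c² = (pn)² stays outside this remainder, to cancel the denominator (pn)² of the
dilogarithm. -/
theorem taylor_remainder_mem (h2 : p ≠ 2) (n : ℕ) {L : ℚ⟦X⟧} (hL : constantCoeff L = 0)
    (hLp : L ∈ pIntegralSeries p) :
    (PowerSeries.mk fun k => ((p * n : ℕ) : ℚ) ^ k / ((k + 2).factorial : ℚ)).subst L ∈
      pIntegralSeries p := by
  refine subst_mem_pIntegralSeries (mem_pIntegralSeries.2 fun k => ?_) hLp hL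
  rw [coeff_mk]
  have : ((p * n : ℕ) : ℚ) ^ k / ((k + 2).factorial : ℚ) =
      (n : ℚ) ^ k * ((p : ℚ) ^ k / ((k + 2).factorial : ℚ)) := by
    push_cast; ring
  rw [this]
  exact mul_mem (pow_mem (natCast_mem_pIntegers n) k) (pow_div_factorial_mem_pIntegers h2 k)

/-- The primitive of the regulator of `f ⊗ (1 - f)`, for `f = q ^ m * u`, `m ≥ 1`. -/
theorem dilog_primitive_mem (h2 : p ≠ 2) {u : ℤ⟦X⟧} (hu : IsUnit u) {m : ℕ} (hm : m ≠ 0)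
    {F L : ℚ⟦X⟧} (hF : F = PowerSeries.map (Int.castRingHom ℚ) (X ^ m * u))
    (hL : L = frobLog p (seriesLog (PowerSeries.map (Int.castRingHom ℚ) u))) :
    (polylog 2).subst F - C ((p : ℚ)⁻¹ ^ 2) * frob p ((polylog 2).subst F) -
      C (p : ℚ)⁻¹ * L * frob p ((polylog 1).subst F) ∈ pIntegralSeries p := by
  have hpq : (p : ℚ) ≠ 0 := Nat.cast_ne_zero.2 hp.out.ne_zero
  have hLp : L ∈ pIntegralSeries p := hL ▸ frobLog_seriesLog_mem h2 hu
  have hL0 : constantCoeff L = 0 := by rw [hL]; exact constantCoeff_frobLog _ (by simp)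
  have hFp : F ∈ pIntegralSeries p := hF ▸ map_mem_pIntegralSeries _
  have hF0 : constantCoeff F = 0 := by rw [hF]; simp [hm]
  have hs := hasSubst_of_constantCoeff_eq_zero hF0
  have hyp : frob p F ∈ pIntegralSeries p := expand_mem_pIntegralSeries hFp _
  have hy0 : constantCoeff (frob p F) = 0 := by simp [hF0]
  -- With y = F(q^p) one has F^(pn) = y^n exp(pnL). Removing the terms of order 0 and 1 in L leaves
  -- (pn)² times an integral series.
  have hterm : ∀ n : ℕ, C (((p * n : ℕ) : ℚ)⁻¹ ^ 2) * (F ^ (p * n) - frob p F ^ n -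
      C ((p * n : ℕ) : ℚ) * L * frob p F ^ n) ∈ pIntegralSeries p := by
    intro n
    rcases Nat.eq_zero_or_pos n with rfl | hn
    · simp
    have hpow : F ^ (p * n) = frob p F ^ n * (exp ℚ).subst (C ((p * n : ℕ) : ℚ) * L) := by
      rw [hF, hL, map_mul, mul_pow, pow_eq_frob_pow_mul_exp h2 hu, map_mul, mul_pow]
      simp only [map_pow, map_X, expand_X]
      ring
    have hne : ((p * n : ℕ) : ℚ) ≠ 0 := Nat.cast_ne_zero.2 (Nat.mul_ne_zero hp.out.ne_zero hn.ne')
    have hCC : (C (((p * n : ℕ) : ℚ)⁻¹ ^ 2) * C (((p * n : ℕ) : ℚ) ^ 2) : ℚ⟦X⟧) = 1 := by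
      rw [← map_mul, ← mul_pow, inv_mul_cancel₀ hne, one_pow, map_one]
    rw [hpow, subst_exp_C_mul _ hL0]
    convert mul_mem (pow_mem hyp n)
      (mul_mem (pow_mem hLp 2) (taylor_remainder_mem h2 n hL0 hLp)) using 1
    linear_combination (frob p F ^ n * (L ^ 2 * (PowerSeries.mk fun k =>
      ((p * n : ℕ) : ℚ) ^ k / ((k + 2).factorial : ℚ)).subst L)) * hCC
  -- The part of the dilogarithm of F with index prime to p.
  have hT : (polylog 2).subst F - C ((p : ℚ)⁻¹ ^ 2) * (polylog 2).subst (F ^ p) ∈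
      pIntegralSeries p := by
    have h := subst_mem_pIntegralSeries (polylog_sub_frob_mem (p := p)) hFp hF0
    have hC : (C ((p : ℚ)⁻¹ ^ 2) : ℚ⟦X⟧).subst F = (C ((p : ℚ)⁻¹ ^ 2) : ℚ⟦X⟧) := subst_C _
    rwa [subst_sub hs, subst_mul hs, subst_expand _ _ hF0, hC] at h
  -- The part with index pn is the sum of the series in `hterm` over n. For the coefficient of
  -- degree N, the terms with n ≤ N suffice.
  have hS : C ((p : ℚ)⁻¹ ^ 2) * ((polylog 2).subst (F ^ p) - (polylog 2).subst (frob p F)) -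
      C (p : ℚ)⁻¹ * L * (polylog 1).subst (frob p F) ∈ pIntegralSeries p := by
    rw [mem_pIntegralSeries]
    intro N
    obtain ⟨a, ha⟩ := X_pow_dvd_subst_sub_sum (a := F ^ p) (by simp [hF0, hp.out.ne_zero])
      (polylog 2) (N + 1)
    obtain ⟨b, hb⟩ := X_pow_dvd_subst_sub_sum hy0 (polylog 2) (N + 1)
    obtain ⟨c, hc⟩ := X_pow_dvd_subst_sub_sum hy0 (polylog 1) (N + 1)
    have hsum : ∑ d ∈ Finset.range (N + 1), C (((p * d : ℕ) : ℚ)⁻¹ ^ 2) * (F ^ (p * d) -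
        frob p F ^ d - C ((p * d : ℕ) : ℚ) * L * frob p F ^ d) =
        C ((p : ℚ)⁻¹ ^ 2) * (∑ d ∈ Finset.range (N + 1), C (coeff d (polylog 2)) * (F ^ p) ^ d -
          ∑ d ∈ Finset.range (N + 1), C (coeff d (polylog 2)) * frob p F ^ d) -
        C (p : ℚ)⁻¹ * L * ∑ d ∈ Finset.range (N + 1), C (coeff d (polylog 1)) * frob p F ^ d := by
      rw [← Finset.sum_sub_distrib, Finset.mul_sum, Finset.mul_sum, ← Finset.sum_sub_distrib]
      refine Finset.sum_congr rfl fun d _ => ?_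
      rw [coeff_polylog, coeff_polylog]
      split_ifs with hd
      · simp [hd]
      · have hdq : (d : ℚ) ≠ 0 := Nat.cast_ne_zero.2 hd
        have e1 : (C (((p * d : ℕ) : ℚ)⁻¹ ^ 2) : ℚ⟦X⟧) =
            C ((p : ℚ)⁻¹ ^ 2) * C (1 / (d : ℚ) ^ 2) := by
          rw [← map_mul]; congr 1; push_cast; field_simp
        have e2 : (C (((p * d : ℕ) : ℚ)⁻¹ ^ 2) * C ((p * d : ℕ) : ℚ) : ℚ⟦X⟧) =
            C (p : ℚ)⁻¹ * C (1 / (d : ℚ) ^ 1) := by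
          rw [← map_mul, ← map_mul]; congr 1; push_cast; field_simp
        rw [pow_mul]
        linear_combination ((F ^ p) ^ d - frob p F ^ d) * e1 - (L * frob p F ^ d) * e2
    have hdec : C ((p : ℚ)⁻¹ ^ 2) * ((polylog 2).subst (F ^ p) - (polylog 2).subst (frob p F)) -
        C (p : ℚ)⁻¹ * L * (polylog 1).subst (frob p F) =
        ∑ d ∈ Finset.range (N + 1), C (((p * d : ℕ) : ℚ)⁻¹ ^ 2) * (F ^ (p * d) -
          frob p F ^ d - C ((p * d : ℕ) : ℚ) * L * frob p F ^ d) +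
        X ^ (N + 1) * (C ((p : ℚ)⁻¹ ^ 2) * (a - b) - C (p : ℚ)⁻¹ * L * c) := by
      rw [hsum]
      linear_combination C ((p : ℚ)⁻¹ ^ 2) * (ha - hb) - C (p : ℚ)⁻¹ * L * hc
    rw [hdec, map_add, coeff_X_pow_mul', if_neg (by omega), add_zero]
    exact mem_pIntegralSeries.1 (sum_mem fun d _ => hterm d) N
  rw [expand_subst_eq _ _ hF0, expand_subst_eq _ _ hF0]
  convert add_mem hT hS using 1
  ring

end Frobenius

/-! ### Units of `ℤ((q))` -/

/-- The order of vanishing of a unit of `ℤ((q))`. -/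
def unitOrd (f : (ℤ⸨X⸩)ˣ) : ℤ := (f : ℤ⸨X⸩).order

/-- The factor `u` in the decomposition `f = q ^ m * u` of a unit of `ℤ((q))`. -/
def unitPart (f : (ℤ⸨X⸩)ˣ) : ℤ⟦X⟧ := (f : ℤ⸨X⸩).powerSeriesPart

theorem unit_eq_single_mul (f : (ℤ⸨X⸩)ˣ) :
    (f : ℤ⸨X⸩) = HahnSeries.single (unitOrd f) 1 * (unitPart f : ℤ⸨X⸩) :=
  (LaurentSeries.single_order_mul_powerSeriesPart _).symm

theorem coeff_single_mul_coe (m : ℤ) (u : ℤ⟦X⟧) (k : ℤ) :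
    (HahnSeries.single m 1 * (u : ℤ⸨X⸩) : ℤ⸨X⸩).coeff k =
      if k < m then 0 else coeff (k - m).natAbs u := by
  have h := HahnSeries.coeff_single_mul_add (r := (1 : ℤ)) (x := (u : ℤ⸨X⸩)) (a := k - m) (b := m)
  rw [sub_add_cancel] at h
  rw [h, one_mul, PowerSeries.coeff_coe]
  simp only [sub_neg]

theorem constantCoeff_unitPart_ne_zero (f : (ℤ⸨X⸩)ˣ) : constantCoeff (unitPart f) ≠ 0 := by
  rw [← coeff_zero_eq_constantCoeff_apply, unitPart, LaurentSeries.powerSeriesPart_coeff]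
  simp

theorem unit_decomposition_unique {f : (ℤ⸨X⸩)ˣ} {m : ℤ} {u : ℤ⟦X⟧} (hu : constantCoeff u ≠ 0)
    (h : (f : ℤ⸨X⸩) = HahnSeries.single m 1 * (u : ℤ⸨X⸩)) : unitOrd f = m ∧ unitPart f = u := by
  have h1 : unitOrd f = m := by
    apply le_antisymm
    · apply HahnSeries.order_le_of_coeff_ne_zero
      rw [h, coeff_single_mul_coe]
      simpa using hu
    · by_contra hlt
      have h2 : (f : ℤ⸨X⸩).coeff (unitOrd f) ≠ 0 := by
        simp [unitOrd]
      rw [h, coeff_single_mul_coe, if_pos (not_le.1 hlt)] at h2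
      exact h2 rfl
  refine ⟨h1, ?_⟩
  apply HahnSeries.ofPowerSeries_injective (Γ := ℤ)
  rw [unitPart, LaurentSeries.ofPowerSeries_powerSeriesPart, show (f : ℤ⸨X⸩).order = m from h1, h,
    ← mul_assoc, HahnSeries.single_mul_single]
  simp

theorem unit_mul_decomposition (f g : (ℤ⸨X⸩)ˣ) :
    unitOrd (f * g) = unitOrd f + unitOrd g ∧ unitPart (f * g) = unitPart f * unitPart g := by
  apply unit_decomposition_unique
  · rw [map_mul]
    exact mul_ne_zero (constantCoeff_unitPart_ne_zero f) (constantCoeff_unitPart_ne_zero g)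
  · rw [Units.val_mul, unit_eq_single_mul f, unit_eq_single_mul g, map_mul, ← one_mul (1 : ℤ),
      ← HahnSeries.single_mul_single, one_mul]
    ring

theorem unitPart_one : unitPart 1 = 1 := by
  refine (unit_decomposition_unique (m := 0) (by simp) ?_).2
  simp

/-- Multiplicativity of `unitPart` provides the inverse. In particular the leading coefficient is
±1. -/
theorem isUnit_unitPart (f : (ℤ⸨X⸩)ˣ) : IsUnit (unitPart f) := by
  refine IsUnit.of_mul_eq_one (unitPart f⁻¹) ?_
  rw [← (unit_mul_decomposition f f⁻¹).2, mul_inv_cancel, unitPart_one]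

theorem unitOrd_inv (f : (ℤ⸨X⸩)ˣ) : unitOrd f⁻¹ = -unitOrd f := by
  have h := (unit_mul_decomposition f f⁻¹).1
  have h1 : unitOrd (1 : (ℤ⸨X⸩)ˣ) = 0 := by simp [unitOrd]
  rw [mul_inv_cancel, h1] at h
  omega

/-- The logarithm of the factor `u` of `f = q ^ m * u`. -/
def unitLog (f : (ℤ⸨X⸩)ˣ) : ℚ⟦X⟧ :=
  seriesLog (PowerSeries.map (Int.castRingHom ℚ) (unitPart f))

@[simp] theorem constantCoeff_unitLog (f : (ℤ⸨X⸩)ˣ) : constantCoeff (unitLog f) = 0 :=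
  constantCoeff_seriesLog _

theorem unitLog_mul (f g : (ℤ⸨X⸩)ˣ) : unitLog (f * g) = unitLog f + unitLog g := by
  rw [unitLog, (unit_mul_decomposition f g).2, map_mul,
    seriesLog_mul (constantCoeff_map_ne_zero (isUnit_unitPart f))
      (constantCoeff_map_ne_zero (isUnit_unitPart g)), unitLog, unitLog]

/-- The homomorphism `unitLog`. -/
def unitLogHom : Additive (ℤ⸨X⸩)ˣ →+ ℚ⟦X⟧ :=
  AddMonoidHom.mk' (fun f => unitLog f.toMul) fun f g => unitLog_mul f.toMul g.toMul

/-- The homomorphism `f ↦ δ f / f`, for a unit `f` of `ℤ((q))`. -/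
def dlogHom : Additive (ℤ⸨X⸩)ˣ →+ ℚ⟦X⟧ :=
  AddMonoidHom.mk' (fun f => C (unitOrd f.toMul : ℚ) + logDerivOp (unitLog f.toMul)) fun f g => by
    rw [toMul_add, unitLog_mul, (unit_mul_decomposition f.toMul g.toMul).1, logDerivOp_add]
    push_cast
    rw [map_add]
    ring

theorem unitLogHom_apply (f : (ℤ⸨X⸩)ˣ) : unitLogHom (Additive.ofMul f) = unitLog f := rfl

theorem dlogHom_apply (f : (ℤ⸨X⸩)ˣ) :
    dlogHom (Additive.ofMul f) = C (unitOrd f : ℚ) + logDerivOp (unitLog f) := rfl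

theorem unitPart_qUnit : unitOrd qUnit = 1 ∧ unitPart qUnit = 1 :=
  unit_decomposition_unique (by simp) (by simp [qUnit])

theorem seriesLog_one : seriesLog 1 = 0 :=
  (eq_seriesLog (by simp) (by simp) (by rw [← map_one C, logDerivOp_C]; simp [logDerivOp])).symm

theorem unitLog_qUnit : unitLog qUnit = 0 := by
  rw [unitLog, unitPart_qUnit.2, map_one, seriesLog_one]

theorem dlogHom_qUnit : dlogHom (Additive.ofMul qUnit) = 1 := by
  rw [dlogHom_apply, unitLog_qUnit, unitPart_qUnit.1]
  simp [logDerivOp]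

/-- The target has no 2-torsion, so -1 maps to 0. -/
theorem map_ofMul_neg (φ : Additive (ℤ⸨X⸩)ˣ →+ ℚ⟦X⟧) (f : (ℤ⸨X⸩)ˣ) :
    φ (Additive.ofMul (-f)) = φ (Additive.ofMul f) := by
  have h1 : φ (Additive.ofMul (-1)) + φ (Additive.ofMul (-1)) = 0 := by
    rw [← map_add, ← ofMul_mul, neg_mul_neg, one_mul, ofMul_one, map_zero]
  have h2 : φ (Additive.ofMul (-1)) = 0 := by
    ext n
    have h3 := congrArg (coeff n) h1
    rw [map_add, map_zero] at h3
    rw [map_zero]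
    linarith
  rw [← neg_one_mul f, ofMul_mul, map_add, h2, zero_add]

/-! ### The regulator -/

section Regulator

variable (p : ℕ) [hp : Fact p.Prime]

/-- The subgroup of logarithmic derivatives of `p`-integral power series. -/
def exactSeries : Submodule ℤ ℚ⟦X⟧ where
  carrier := {h | ∃ g ∈ pIntegralSeries p, logDerivOp g = h}
  zero_mem' := ⟨0, zero_mem _, by simp [logDerivOp]⟩
  add_mem' := by
    rintro _ _ ⟨a, ha, rfl⟩ ⟨b, hb, rfl⟩
    exact ⟨a + b, add_mem ha hb, logDerivOp_add a b⟩
  smul_mem' := by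
    rintro c _ ⟨a, ha, rfl⟩
    refine ⟨c • a, zsmul_mem ha c, ?_⟩
    rw [← Int.cast_smul_eq_zsmul ℚ, smul_eq_C_mul, logDerivOp_C_mul, ← smul_eq_C_mul,
      Int.cast_smul_eq_zsmul]

/-- The coefficientwise form is what allows division by 2 and passage to q-adic limits. -/
theorem mem_exactSeries {h : ℚ⟦X⟧} :
    h ∈ exactSeries p ↔ ∀ n, ∃ a ∈ pIntegers p, coeff n h = n * a := by
  constructor
  · rintro ⟨g, hg, rfl⟩ n
    exact ⟨coeff n g, mem_pIntegralSeries.1 hg n, coeff_logDerivOp g n⟩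
  · intro H
    choose a ha hn using H
    refine ⟨PowerSeries.mk a, mem_pIntegralSeries.2 fun n => by simpa using ha n, ?_⟩
    ext n
    rw [coeff_logDerivOp, coeff_mk, hn]

variable {p} in
theorem mem_exactSeries_of_two_smul (h2 : p ≠ 2) {h : ℚ⟦X⟧} (hh : (2 : ℤ) • h ∈ exactSeries p) :
    h ∈ exactSeries p := by
  rw [mem_exactSeries] at hh ⊢
  intro n
  obtain ⟨a, ha, hn⟩ := hh n
  have h2' : ¬ p ∣ 2 := fun hd => h2 ((Nat.prime_dvd_prime_iff_eq hp.out Nat.prime_two).1 hd)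
  refine ⟨((2 : ℕ) : ℚ)⁻¹ * a, mul_mem (inv_natCast_mem_pIntegers h2') ha, ?_⟩
  rw [map_zsmul, zsmul_eq_mul] at hn
  push_cast at hn ⊢
  linear_combination hn / 2

/-- The homomorphism `f ↦ log f - p⁻¹ log f(q ^ p)`. -/
def frobLogHom : Additive (ℤ⸨X⸩)ˣ →+ ℚ⟦X⟧ := (frobLog p).toAddMonoidHom.comp unitLogHom

theorem frobLogHom_apply (f : (ℤ⸨X⸩)ˣ) :
    frobLogHom p (Additive.ofMul f) = frobLog p (unitLog f) := rfl

/-- The `p`-adic regulator on `ℤ((q))ˣ ⊗ ℤ((q))ˣ`. -/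
def regulator : Additive (ℤ⸨X⸩)ˣ →ₗ[ℤ] Additive (ℤ⸨X⸩)ˣ →ₗ[ℤ] ℚ⟦X⟧ :=
  (LinearMap.mul ℤ ℚ⟦X⟧).compl₁₂ (frobLogHom p).toIntLinearMap
      ((frob p).toRingHom.toAddMonoidHom.comp dlogHom).toIntLinearMap -
    (LinearMap.mul ℤ ℚ⟦X⟧).compl₁₂ dlogHom.toIntLinearMap (frobLogHom p).toIntLinearMap

theorem regulator_apply (f g : Additive (ℤ⸨X⸩)ˣ) :
    regulator p f g = frobLogHom p f * frob p (dlogHom g) - dlogHom f * frobLogHom p g := rfl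

theorem logDerivOp_frobLogHom (f : Additive (ℤ⸨X⸩)ˣ) :
    logDerivOp (frobLogHom p f) = dlogHom f - frob p (dlogHom f) := by
  obtain ⟨f, rfl⟩ := Additive.ofMul.surjective f
  rw [frobLogHom_apply, dlogHom_apply, logDerivOp_frobLog, map_add, expand_C]
  ring

variable {p}

theorem frobLogHom_mem (h2 : p ≠ 2) (f : Additive (ℤ⸨X⸩)ˣ) :
    frobLogHom p f ∈ pIntegralSeries p :=
  frobLog_seriesLog_mem h2 (isUnit_unitPart f.toMul)

/-! ### The Steinberg relation for the regulator -/

/-- Since δL(f) = D(f) - φD(f), the symmetrised regulator is -δ(L(f) L(g)). -/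
theorem regulator_add_swap_mem (h2 : p ≠ 2) (f g : Additive (ℤ⸨X⸩)ˣ) :
    regulator p f g + regulator p g f ∈ exactSeries p := by
  refine ⟨-(frobLogHom p f * frobLogHom p g),
    neg_mem (mul_mem (frobLogHom_mem h2 f) (frobLogHom_mem h2 g)), ?_⟩
  rw [logDerivOp_neg, logDerivOp_mul, logDerivOp_frobLogHom, logDerivOp_frobLogHom,
    regulator_apply, regulator_apply]
  ring

theorem regulator_swap_mem (h2 : p ≠ 2) {f g : Additive (ℤ⸨X⸩)ˣ}
    (h : regulator p f g ∈ exactSeries p) : regulator p g f ∈ exactSeries p := by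
  have := sub_mem (regulator_add_swap_mem h2 f g) h
  rwa [add_sub_cancel_left] at this

/-- The regulator ignores signs, so antisymmetry makes twice the value exact, and 2 is invertible at
p. -/
theorem regulator_neg_mem (h2 : p ≠ 2) (f : (ℤ⸨X⸩)ˣ) :
    regulator p (Additive.ofMul f) (Additive.ofMul (-f)) ∈ exactSeries p := by
  rw [regulator_apply, map_ofMul_neg dlogHom, map_ofMul_neg (frobLogHom p), ← regulator_apply]
  apply mem_exactSeries_of_two_smul h2
  rw [two_smul]
  exact regulator_add_swap_mem h2 _ _

/-- Positive order allows substituting f into polylogarithms. As ℓ(1 - f) = -Li_1(f) and δ Li_2(f) =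
D(f) Li_1(f), applying δ to Li_2(f) - p⁻² φLi_2(f) - p⁻¹ L(f) φLi_1(f) yields the regulator. -/
theorem regulator_one_sub_mem_of_pos (h2 : p ≠ 2) {f g : (ℤ⸨X⸩)ˣ} (hfg : (g : ℤ⸨X⸩) = 1 - f)
    (hf : 0 < unitOrd f) :
    regulator p (Additive.ofMul f) (Additive.ofMul g) ∈ exactSeries p := by
  obtain ⟨m, hm⟩ := Int.eq_ofNat_of_zero_le hf.le
  have hm0 : m ≠ 0 := by rintro rfl; simp [hm] at hf
  have hfX : (f : ℤ⸨X⸩) = ((X ^ m * unitPart f : ℤ⟦X⟧) : ℤ⸨X⸩) := by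
    rw [map_mul, HahnSeries.ofPowerSeries_X_pow, ← hm, ← unit_eq_single_mul]
  obtain ⟨hg0, hg⟩ := unit_decomposition_unique (f := g) (m := 0) (u := 1 - X ^ m * unitPart f)
    (by simp [hm0]) (by rw [hfg, hfX]; simp)
  set F : ℚ⟦X⟧ := PowerSeries.map (Int.castRingHom ℚ) (X ^ m * unitPart f) with hF
  have hF0 : constantCoeff F = 0 := by simp [hF, hm0]
  have hgl : unitLog g = -(polylog 1).subst F := by
    rw [unitLog, hg, map_sub, map_one, seriesLog_one_sub hF0]
  have hdg : dlogHom (Additive.ofMul g) = -logDerivOp ((polylog 1).subst F) := by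
    rw [dlogHom_apply, hg0, hgl, logDerivOp_neg]; simp
  have hdF : logDerivOp F = dlogHom (Additive.ofMul f) * F := by
    have hX : logDerivOp (X : ℚ⟦X⟧) = 1 * X := by simp [logDerivOp]
    rw [hF, map_mul, logDerivOp_mul, map_pow, map_X, logDerivOp_pow_of_eq_mul hX, dlogHom_apply,
      logDerivOp_seriesLog_mul (constantCoeff_map_ne_zero (isUnit_unitPart f)), hm, unitLog]
    simp only [Int.cast_natCast, map_natCast]
    ring
  refine ⟨_, dilog_primitive_mem h2 (isUnit_unitPart f) hm0 hF
    (L := frobLogHom p (Additive.ofMul f)) rfl, ?_⟩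
  have hCC : (C (p : ℚ) * C ((p : ℚ)⁻¹ ^ 2) : ℚ⟦X⟧) = C (p : ℚ)⁻¹ := by
    rw [map_pow]; linear_combination C (p : ℚ)⁻¹ * C_mul_C_inv_prime (p := p)
  rw [regulator_apply, hdg, frobLogHom_apply p g, hgl, map_neg, frobLog_apply, logDerivOp_sub,
    logDerivOp_sub, logDerivOp_C_mul, mul_assoc, logDerivOp_C_mul, logDerivOp_mul, logDerivOp_frob,
    logDerivOp_frob, logDerivOp_frobLogHom, logDerivOp_polylog_succ_subst 1 hF0 hdF, map_mul,
    map_neg]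
  linear_combination
    (-frob p (dlogHom (Additive.ofMul f)) * frob p ((polylog 1).subst F)) * hCC -
    (frobLogHom p (Additive.ofMul f) * frob p (logDerivOp ((polylog 1).subst F))) *
      C_mul_C_inv_prime (p := p)

theorem regulator_one_sub_mem_of_ne_zero (h2 : p ≠ 2) {f g : (ℤ⸨X⸩)ˣ}
    (hfg : (g : ℤ⸨X⸩) = 1 - f) (hf : unitOrd f ≠ 0) :
    regulator p (Additive.ofMul f) (Additive.ofMul g) ∈ exactSeries p := by
  rcases lt_or_gt_of_ne hf with hneg | hpos
  · have hinv : 0 < unitOrd f⁻¹ := by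
      rw [unitOrd_inv]
      omega
    -- Negative order reduces to f⁻¹ through 1 - f = (-f)(1 - f⁻¹).
    have hh : ((-f⁻¹ * g : (ℤ⸨X⸩)ˣ) : ℤ⸨X⸩) = 1 - (f⁻¹ : (ℤ⸨X⸩)ˣ) := by
      rw [Units.val_mul, hfg, Units.val_neg]
      linear_combination f.inv_mul
    have h := regulator_one_sub_mem_of_pos h2 hh hinv
    have hg : g = -f * (-f⁻¹ * g) := by simp
    rw [hg, ofMul_mul, map_add]
    refine add_mem (regulator_neg_mem h2 f) ?_
    rw [ofMul_inv, map_neg, LinearMap.neg_apply] at h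
    exact neg_mem_iff.1 h
  · exact regulator_one_sub_mem_of_pos h2 hfg hpos

theorem regulator_one_sub_mem (h2 : p ≠ 2) {f g : (ℤ⸨X⸩)ˣ} (hfg : (g : ℤ⸨X⸩) = 1 - f) :
    regulator p (Additive.ofMul f) (Additive.ofMul g) ∈ exactSeries p := by
  by_cases hf : unitOrd f = 0
  · by_cases hg : unitOrd g = 0
    -- If f and 1 - f both had order 0, their constant terms ±1 would sum to 1, which parity
    -- forbids. Otherwise the roles of f and 1 - f are exchanged.
    · exfalso
      have h : unitPart g = 1 - unitPart f := by
        apply HahnSeries.ofPowerSeries_injective (Γ := ℤ)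
        have h1 := unit_eq_single_mul f
        have h2 := unit_eq_single_mul g
        rw [hf] at h1
        rw [hg] at h2
        rw [map_sub, map_one]
        simpa using (h2.symm.trans hfg).trans (congrArg (1 - ·) h1)
      have h1 := congrArg constantCoeff h
      rw [map_sub, map_one] at h1
      rcases Int.isUnit_iff.1 (isUnit_iff_constantCoeff.1 (isUnit_unitPart f)) with h3 | h3 <;>
      rcases Int.isUnit_iff.1 (isUnit_iff_constantCoeff.1 (isUnit_unitPart g)) with h4 | h4 <;>
      rw [h3, h4] at h1 <;> omega
    · exact regulator_swap_mem h2
        (regulator_one_sub_mem_of_ne_zero h2 (by rw [hfg]; ring) hg)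
  · exact regulator_one_sub_mem_of_ne_zero h2 hfg hf

theorem regulator_mem_of_algOrthogonal (h2 : p ≠ 2) {f g : (ℤ⸨X⸩)ˣ} (h : AlgOrthogonal f g) :
    regulator p (Additive.ofMul f) (Additive.ofMul g) ∈ exactSeries p := by
  have hle : steinbergSubgroup ℤ⸨X⸩ ≤ (exactSeries p).comap (TensorProduct.lift (regulator p)) := by
    refine Submodule.span_le.2 ?_
    rintro _ ⟨a, b, hab, rfl⟩
    exact regulator_one_sub_mem h2 hab
  rw [AlgOrthogonal, symbol, ← map_smul, Submodule.mkQ_apply, Submodule.Quotient.mk_eq_zero] at h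
  have h3 : TensorProduct.lift (regulator p)
    ((2 : ℤ) • (Additive.ofMul f ⊗ₜ[ℤ] Additive.ofMul g)) ∈ exactSeries p := hle h
  rw [map_smul] at h3
  exact mem_exactSeries_of_two_smul h2 h3

end Regulator

/-! ### Expansions in polylogarithms -/

/-- The coefficients of the expansion of `V` in the series `Li_s(z ^ d)`. -/
def polylogCoeff (s : ℕ) (V : ℚ⟦X⟧) : ℕ → ℚ
  | 0 => 0
  | j + 1 => coeff (j + 1) V - ∑ i : Fin j, polylogCoeff s V (i + 1) *
      coeff (j + 1) (expand (i + 1) (Nat.succ_ne_zero i) (polylog s))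

theorem coeff_expand_self (d : ℕ) (hd : d ≠ 0) (f : ℚ⟦X⟧) :
    coeff d (expand d hd f) = coeff 1 f := by
  rw [coeff_expand, if_pos dvd_rfl, Nat.div_self (Nat.pos_of_ne_zero hd)]

theorem coeff_one_polylog (s : ℕ) : coeff 1 (polylog s) = 1 := by
  simp [coeff_polylog]

/-- The system is unitriangular: Li_s(z^d) has leading term z^d. -/
theorem isPolylogSum_polylogCoeff (s : ℕ) {V : ℚ⟦X⟧} (hV : constantCoeff V = 0) :
    IsPolylogSum s (polylogCoeff s V) V := by
  intro k
  cases k with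
  | zero => simpa using hV
  | succ j =>
    rw [Finset.sum_range_succ, coeff_expand_self, coeff_one_polylog, mul_one, polylogCoeff,
      Finset.sum_range fun i => polylogCoeff s V (i + 1) *
        coeff (j + 1) (expand (i + 1) (Nat.succ_ne_zero i) (polylog s))]
    ring

theorem IsPolylogSum.unique {s : ℕ} {V : ℚ⟦X⟧} {n n' : ℕ → ℚ} (h : IsPolylogSum s n V)
    (h' : IsPolylogSum s n' V) (j : ℕ) : n (j + 1) = n' (j + 1) := by
  induction j using Nat.strong_induction_on with
  | _ j ih =>
    have h1 := (h (j + 1)).symm.trans (h' (j + 1))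
    rw [Finset.sum_range_succ, Finset.sum_range_succ, coeff_expand_self, coeff_one_polylog, mul_one,
      mul_one, Finset.sum_congr rfl fun i hi => by rw [ih i (Finset.mem_range.1 hi)]] at h1
    exact add_left_cancel h1

theorem coeff_expand_polylog_of_lt (s : ℕ) {k d : ℕ} (hd : d ≠ 0) (h : k < d) :
    coeff k (expand d hd (polylog s)) = 0 := by
  rw [coeff_expand]
  split_ifs with hdvd
  · rw [Nat.div_eq_of_lt h, coeff_polylog, if_pos rfl]
  · rfl

theorem IsPolylogSum.coeff_eq {s : ℕ} {V : ℚ⟦X⟧} {n : ℕ → ℚ} (h : IsPolylogSum s n V) {k N : ℕ}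
    (hk : k ≤ N) : coeff k V = ∑ i ∈ Finset.range N,
      n (i + 1) * coeff k (expand (i + 1) i.succ_ne_zero (polylog s)) := by
  rw [h k]
  refine Finset.sum_subset (Finset.range_mono hk) fun i _ hi => ?_
  rw [coeff_expand_polylog_of_lt s _ (by simpa [Nat.lt_succ_iff] using hi), mul_zero]

theorem IsPolylogSum.constantCoeff_eq_zero {s : ℕ} {V : ℚ⟦X⟧} {n : ℕ → ℚ}
    (h : IsPolylogSum s n V) : constantCoeff V = 0 := by
  simpa using h 0

section

variable {p : ℕ} [hp : Fact p.Prime]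

theorem expand_frob {k : ℕ} (hk : k ≠ 0) (f : ℚ⟦X⟧) :
    expand k hk (frob p f) = frob p (expand k hk f) := by
  rw [← expand_mul, ← expand_mul]
  congr 2
  exact mul_comm _ _

theorem IsPolylogSum.coeff_sub_frob {V : ℚ⟦X⟧} {n : ℕ → ℚ} (h : IsPolylogSum 2 n V) (k : ℕ) :
    coeff k (V - C ((p : ℚ)⁻¹ ^ 2) * frob p V) = ∑ i ∈ Finset.range k, n (i + 1) *
      coeff k (expand (i + 1) i.succ_ne_zero
        (polylog 2 - C ((p : ℚ)⁻¹ ^ 2) * frob p (polylog 2))) := by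
  have h1 : coeff k (frob p V) = ∑ i ∈ Finset.range k, n (i + 1) *
      coeff k (frob p (expand (i + 1) i.succ_ne_zero (polylog 2))) := by
    simp only [coeff_expand p hp.out.ne_zero]
    split_ifs with hd
    · exact h.coeff_eq (Nat.div_le_self k p)
    · simp
  rw [map_sub, coeff_C_mul, h k, h1, Finset.mul_sum, ← Finset.sum_sub_distrib]
  refine Finset.sum_congr rfl fun i _ => ?_
  rw [map_sub, map_mul, expand_C, expand_frob (p := p), map_sub, coeff_C_mul]
  ring

/-- V - p⁻² φV has the same coefficients n_d as V, but with respect to T(z^d), where T = Li_2 - p⁻²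
φLi_2 is integral with leading term z. Solving this unitriangular system stays in the p-integers. -/
theorem IsPolylogSum.mem_pIntegers {V : ℚ⟦X⟧} {n : ℕ → ℚ} (h : IsPolylogSum 2 n V)
    (hV : V - C ((p : ℚ)⁻¹ ^ 2) * frob p V ∈ pIntegralSeries p) (j : ℕ) :
    n (j + 1) ∈ pIntegers p := by
  induction j using Nat.strong_induction_on with
  | _ j ih =>
    have hT := polylog_sub_frob_mem (p := p)
    have h1 : coeff 1 (polylog 2 - C ((p : ℚ)⁻¹ ^ 2) * frob p (polylog 2)) = 1 := by
      rw [map_sub, coeff_C_mul, coeff_one_polylog,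
        coeff_expand_of_not_dvd _ _ _ (by simpa using hp.out.ne_one), mul_zero, sub_zero]
    have h2 := h.coeff_sub_frob (p := p) (j + 1)
    rw [Finset.sum_range_succ, coeff_expand_self, h1, mul_one] at h2
    rw [eq_sub_iff_add_eq'.2 h2.symm]
    refine sub_mem (mem_pIntegralSeries.1 hV _) (sum_mem fun i hi => ?_)
    exact mul_mem (ih i (Finset.mem_range.1 hi))
      (mem_pIntegralSeries.1 (expand_mem_pIntegralSeries hT _) _)

/-- Dwork-type criterion for 2-functions at `p`. -/
theorem isSFunctionAt_of_sub_frob_mem {V : ℚ⟦X⟧} (h0 : constantCoeff V = 0)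
    (hV : V - C ((p : ℚ)⁻¹ ^ 2) * frob p V ∈ pIntegralSeries p) : IsSFunctionAt p 2 V := by
  refine ⟨polylogCoeff 2 V, fun d => ?_, isPolylogSum_polylogCoeff 2 h0⟩
  rw [← TwoFunctions.mem_pIntegers]
  cases d with
  | zero => rw [polylogCoeff]; exact zero_mem _
  | succ j => exact (isPolylogSum_polylogCoeff 2 h0).mem_pIntegers hV j

/-- Here δ(V - p⁻² φV) = δV - p⁻¹ φδV, because δφ = pφδ. So V - p⁻² φV differs from an integral
primitive by a p-integral constant. -/
theorem isSFunctionAt_of_frobLog_logDerivOp_mem {V : ℚ⟦X⟧} (h0 : constantCoeff V = 0)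
    (hV : frobLog p (logDerivOp V) ∈ exactSeries p) : IsSFunctionAt p 2 V := by
  refine isSFunctionAt_of_sub_frob_mem h0 ?_
  obtain ⟨g, hg, hgV⟩ := hV
  have hCC : (C (p : ℚ) * C ((p : ℚ)⁻¹ ^ 2) : ℚ⟦X⟧) = C (p : ℚ)⁻¹ := by
    rw [map_pow]; linear_combination C (p : ℚ)⁻¹ * C_mul_C_inv_prime (p := p)
  have : V - C ((p : ℚ)⁻¹ ^ 2) * frob p V = g - C (constantCoeff g) := by
    apply logDerivOp_injective
    · simp [h0]
    · rw [logDerivOp_sub, logDerivOp_sub, logDerivOp_C_mul, logDerivOp_frob, logDerivOp_C, hgV,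
        frobLog_apply]
      linear_combination (-frob p (logDerivOp V)) * hCC
  rw [this]
  refine sub_mem hg (C_mem_pIntegralSeries ?_)
  rw [← coeff_zero_eq_constantCoeff_apply]
  exact mem_pIntegralSeries.1 hg 0

end

/-- The expansion coefficients are unique, so one and the same sequence is integral at all primes.
-/
theorem isSFunction_of_forall_prime {s : ℕ} {V : ℚ⟦X⟧}
    (h : ∀ p : ℕ, p.Prime → IsSFunctionAt p s V) : IsSFunction s V := by
  have h0 : constantCoeff V = 0 := by
    obtain ⟨n, -, hn⟩ := h 2 Nat.prime_two
    exact hn.constantCoeff_eq_zero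
  have hV := isPolylogSum_polylogCoeff s h0
  have hden : ∀ j, (polylogCoeff s V (j + 1)).den = 1 := by
    intro j
    by_contra hne
    obtain ⟨p, hp, hpd⟩ := Nat.exists_prime_and_dvd hne
    obtain ⟨n, hn, hnV⟩ := h p hp
    exact hn (j + 1) (hnV.unique hV j ▸ hpd)
  refine ⟨fun d => (polylogCoeff s V d).num, fun k => ?_⟩
  rw [hV k]
  refine Finset.sum_congr rfl fun i _ => ?_
  simp only [Rat.coe_int_num_of_den_eq_one (hden i)]

/-! ### Continuity of the regulator -/

theorem tendsto_qAdicUnits_iff {F : ℕ → (ℤ⸨X⸩)ˣ} {f : (ℤ⸨X⸩)ˣ} :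
    Filter.Tendsto F Filter.atTop (@nhds _ (qAdicUnitsTopology ℤ) f) ↔
      ∀ N : ℤ, ∀ᶠ n in Filter.atTop, ∀ k < N, ((F n : ℤ⸨X⸩) - f).coeff k = 0 := by
  let _ := qAdicTopology ℤ
  let _ := qAdicUnitsTopology ℤ
  rw [tendsto_nhds]
  constructor
  · intro h N
    let U : Set ℤ⸨X⸩ := {g | ∀ k < N, (g - f).coeff k = 0}
    have hU : IsOpen U := by
      intro g hg
      refine ⟨N, fun g' hg' k hk => ?_⟩
      have : g' - (f : ℤ⸨X⸩) = (g' - g) + (g - f) := by ring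
      rw [this, HahnSeries.coeff_add, hg' k hk, hg k hk, add_zero]
    exact h (Units.val ⁻¹' U) ⟨U, hU, rfl⟩ (by simp [U])
  · rintro h s ⟨U, hU, rfl⟩ hf
    obtain ⟨N, hN⟩ := hU f hf
    exact (h N).mono fun n hn => hN _ hn

theorem eq_single_mul_of_coeff_eq_zero {x : ℤ⸨X⸩} {M : ℤ} (hx : ∀ k < M, x.coeff k = 0) :
    ∃ w : ℤ⟦X⟧, x = HahnSeries.single M 1 * (w : ℤ⸨X⸩) := by
  refine ⟨PowerSeries.mk fun n => x.coeff (M + n), ?_⟩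
  ext k
  rw [coeff_single_mul_coe]
  split_ifs with hk
  · exact hx k hk
  · rw [coeff_mk]
    congr 1
    omega

/-- Additive closeness becomes multiplicative through f⁻¹g = 1 + f⁻¹(g - f), where f⁻¹ shifts
degrees by minus the order of f. -/
theorem unit_close {f g : (ℤ⸨X⸩)ˣ} {N : ℕ} (hN : N ≠ 0)
    (h : ∀ k < unitOrd f + N, ((g : ℤ⸨X⸩) - f).coeff k = 0) :
    unitOrd (f⁻¹ * g) = 0 ∧ X ^ N ∣ unitPart (f⁻¹ * g) - 1 := by
  obtain ⟨w, hw⟩ := eq_single_mul_of_coeff_eq_zero h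
  have h1 : ((f⁻¹ * g : (ℤ⸨X⸩)ˣ) : ℤ⸨X⸩) = HahnSeries.single 0 1 *
      ((1 + X ^ N * (unitPart f⁻¹ * w) : ℤ⟦X⟧) : ℤ⸨X⸩) := by
    have h2 : ((f⁻¹ * g : (ℤ⸨X⸩)ˣ) : ℤ⸨X⸩) = 1 + (f⁻¹ : (ℤ⸨X⸩)ˣ) * ((g : ℤ⸨X⸩) - f) := by
      rw [Units.val_mul]; linear_combination f.inv_mul
    have h3 : (HahnSeries.single (N : ℤ) (1 : ℤ) : ℤ⸨X⸩) =
        HahnSeries.single (unitOrd f⁻¹) 1 * HahnSeries.single (unitOrd f + N) 1 := by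
      rw [HahnSeries.single_mul_single, unitOrd_inv]; simp
    rw [h2, hw, unit_eq_single_mul f⁻¹]
    simp only [map_add, map_one, map_mul, HahnSeries.ofPowerSeries_X_pow, h3]
    rw [show (HahnSeries.single (0 : ℤ) (1 : ℤ) : ℤ⸨X⸩) = 1 from rfl]
    ring
  obtain ⟨h4, h5⟩ := unit_decomposition_unique (by simp [hN]) h1
  exact ⟨h4, h5 ▸ ⟨unitPart f⁻¹ * w, by ring⟩⟩

theorem X_pow_dvd_logDerivOp {f : ℚ⟦X⟧} {N : ℕ} (h : X ^ N ∣ f) : X ^ N ∣ logDerivOp f := by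
  rw [X_pow_dvd_iff] at h ⊢
  intro n hn
  rw [coeff_logDerivOp, h n hn, mul_zero]

theorem X_pow_dvd_of_logDerivOp {f : ℚ⟦X⟧} {N : ℕ} (h0 : constantCoeff f = 0)
    (h : X ^ N ∣ logDerivOp f) : X ^ N ∣ f := by
  rw [X_pow_dvd_iff] at h ⊢
  intro n hn
  rcases Nat.eq_zero_or_pos n with rfl | hpos
  · simpa using h0
  · have := h n hn
    rw [coeff_logDerivOp] at this
    exact (mul_eq_zero.1 this).resolve_left (Nat.cast_ne_zero.2 hpos.ne')

theorem map_X_pow_dvd {u : ℤ⟦X⟧} {N : ℕ} (h : X ^ N ∣ u) :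
    X ^ N ∣ PowerSeries.map (Int.castRingHom ℚ) u := by
  simpa using map_dvd (PowerSeries.map (Int.castRingHom ℚ)) h

theorem X_pow_dvd_unitLog {f : (ℤ⸨X⸩)ˣ} {N : ℕ} (h : X ^ N ∣ unitPart f - 1) :
    X ^ N ∣ unitLog f := by
  refine X_pow_dvd_of_logDerivOp (by simp) ?_
  rw [unitLog, seriesLog, logDerivOp_dlogIntegral (by simp)]
  refine Dvd.dvd.mul_right ?_ _
  have h1 := X_pow_dvd_logDerivOp (map_X_pow_dvd h)
  rwa [map_sub, map_one, logDerivOp_sub, ← map_one C, logDerivOp_C, sub_zero] at h1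

theorem eventually_unit_close {f : (ℤ⸨X⸩)ˣ} {F : ℕ → (ℤ⸨X⸩)ˣ}
    (h : Filter.Tendsto F Filter.atTop (@nhds _ (qAdicUnitsTopology ℤ) f)) {N : ℕ} (hN : N ≠ 0) :
    ∀ᶠ n in Filter.atTop, unitOrd (f⁻¹ * F n) = 0 ∧ X ^ N ∣ unitPart (f⁻¹ * F n) - 1 :=
  (tendsto_qAdicUnits_iff.1 h (unitOrd f + N)).mono fun _ hn => unit_close hN hn

section

variable {p : ℕ} [hp : Fact p.Prime]

theorem X_pow_dvd_frob {f : ℚ⟦X⟧} {N : ℕ} (h : X ^ N ∣ f) : X ^ N ∣ frob p f := by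
  have h1 := map_dvd (frob p) h
  rw [map_pow, expand_X, ← pow_mul] at h1
  exact (pow_dvd_pow X (Nat.le_mul_of_pos_left N hp.out.pos)).trans h1

theorem X_pow_dvd_dlogHom {h : (ℤ⸨X⸩)ˣ} {N : ℕ}
    (hh : unitOrd h = 0 ∧ X ^ N ∣ unitPart h - 1) : X ^ N ∣ dlogHom (Additive.ofMul h) := by
  rw [dlogHom_apply, hh.1]
  simpa using X_pow_dvd_logDerivOp (X_pow_dvd_unitLog hh.2)

theorem X_pow_dvd_frobLogHom {h : (ℤ⸨X⸩)ˣ} {N : ℕ}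
    (hh : unitOrd h = 0 ∧ X ^ N ∣ unitPart h - 1) : X ^ N ∣ frobLogHom p (Additive.ofMul h) := by
  rw [frobLogHom_apply, frobLog_apply]
  have h1 := X_pow_dvd_unitLog hh.2
  exact dvd_sub h1 ((X_pow_dvd_frob h1).mul_left _)

theorem regulator_mem_of_orthogonal (h2 : p ≠ 2) {f g : (ℤ⸨X⸩)ˣ} (h : Orthogonal f g) :
    regulator p (Additive.ofMul f) (Additive.ofMul g) ∈ exactSeries p := by
  obtain ⟨F, G, hF, hG, hFG⟩ := h
  rw [mem_exactSeries]
  intro k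
  -- Agreement up to factors in 1 + q^(k+1) ℤ[[q]] fixes the coefficient of degree k of the
  -- regulator, by bilinearity.
  obtain ⟨n, hFn, hGn⟩ := ((eventually_unit_close hF k.succ_ne_zero).and
    (eventually_unit_close hG k.succ_ne_zero)).exists
  obtain ⟨a, ha, hk⟩ := (mem_exactSeries p).1 (regulator_mem_of_algOrthogonal h2 (hFG n)) k
  refine ⟨a, ha, ?_⟩
  rw [← hk]
  have e1 : F n = f * (f⁻¹ * F n) := by simp
  have e2 : G n = g * (g⁻¹ * G n) := by simp
  have e : regulator p (Additive.ofMul (F n)) (Additive.ofMul (G n)) =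
      regulator p (Additive.ofMul f) (Additive.ofMul g) +
      (regulator p (Additive.ofMul f) (Additive.ofMul (g⁻¹ * G n)) +
        regulator p (Additive.ofMul (f⁻¹ * F n)) (Additive.ofMul (G n))) := by
    conv_lhs => rw [e1, ofMul_mul, map_add, LinearMap.add_apply]
    conv_lhs => enter [1]; rw [e2, ofMul_mul, map_add]
    rw [add_assoc]
  have hd : X ^ (k + 1) ∣ regulator p (Additive.ofMul f) (Additive.ofMul (g⁻¹ * G n)) +
      regulator p (Additive.ofMul (f⁻¹ * F n)) (Additive.ofMul (G n)) := by
    rw [regulator_apply, regulator_apply]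
    refine dvd_add (dvd_sub ?_ ?_) (dvd_sub ?_ ?_)
    · exact (X_pow_dvd_frob (X_pow_dvd_dlogHom hGn)).mul_left _
    · exact (X_pow_dvd_frobLogHom hGn).mul_left _
    · exact (X_pow_dvd_frobLogHom hFn).mul_right _
    · exact (X_pow_dvd_dlogHom hFn).mul_right _
  rw [e, map_add, X_pow_dvd_iff.1 hd k k.lt_succ_self, add_zero]

/-- Evaluation of r(f,q) = L(f). Both orders of the symbol occur in the theorem. -/
theorem frobLog_unitLog_mem_of_orthogonal_qUnit (h2 : p ≠ 2) {f : (ℤ⸨X⸩)ˣ}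
    (h : Orthogonal f qUnit ∨ Orthogonal qUnit f) : frobLog p (unitLog f) ∈ exactSeries p := by
  have h1 : regulator p (Additive.ofMul f) (Additive.ofMul qUnit) ∈ exactSeries p := by
    rcases h with h | h
    · exact regulator_mem_of_orthogonal h2 h
    · exact regulator_swap_mem h2 (regulator_mem_of_orthogonal h2 h)
  rw [regulator_apply, dlogHom_qUnit, frobLogHom_apply, frobLogHom_apply, unitLog_qUnit] at h1
  simpa using h1

end

/-! ### Logarithms of the units in the theorem -/

theorem unitLog_of_map_eq {Y : (ℤ⸨X⸩)ˣ} {w : ℚ⟦X⟧} (hw : constantCoeff w ≠ 0)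
    (h : HahnSeries.map (Y : ℤ⸨X⸩) (Int.castRingHom ℚ) = (w : ℚ⸨X⸩)) :
    unitLog Y = seriesLog w := by
  have hc : ∀ k : ℤ, (((Y : ℤ⸨X⸩).coeff k : ℤ) : ℚ) = (w : ℚ⸨X⸩).coeff k := fun k => by
    rw [← h]; rfl
  obtain ⟨u, hu⟩ := eq_single_mul_of_coeff_eq_zero (x := (Y : ℤ⸨X⸩)) (M := 0) fun k hk => by
    have := hc k
    rw [PowerSeries.coeff_coe, if_pos hk] at this
    exact_mod_cast this
  have huw : PowerSeries.map (Int.castRingHom ℚ) u = w := by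
    ext n
    have h1 := hc n
    rw [hu, coeff_single_mul_coe, LaurentSeries.coeff_coe_powerSeries, if_neg (by omega)] at h1
    simpa using h1
  have hu0 : constantCoeff u ≠ 0 := by
    rintro h0
    apply hw
    rw [← huw]
    simp [h0]
  rw [unitLog, (unit_decomposition_unique hu0 hu).2, huw]

theorem isSFunctionAt_of_expNegLogDeriv_orthogonal {W : ℚ⟦X⟧} {Y : (ℤ⸨X⸩)ˣ}
    (hW : constantCoeff W = 0)
    (hY : HahnSeries.map (Y : ℤ⸨X⸩) (Int.castRingHom ℚ) = (expNegLogDeriv W : ℚ⸨X⸩))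
    (h : Orthogonal Y qUnit) {p : ℕ} (hp : p.Prime) (h2 : p ≠ 2) : IsSFunctionAt p 2 W := by
  have : Fact p.Prime := ⟨hp⟩
  have h0 : constantCoeff (-logDerivOp W) = 0 := by simp
  have h1 : unitLog Y = -logDerivOp W := by
    rw [unitLog_of_map_eq _ hY, expNegLogDeriv, seriesLog_subst_exp h0]
    rw [expNegLogDeriv, constantCoeff_subst_of_constantCoeff_eq_zero _ h0]
    simp
  have h3 := frobLog_unitLog_mem_of_orthogonal_qUnit h2 (Or.inl h)
  rw [h1, map_neg, neg_mem_iff] at h3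
  exact isSFunctionAt_of_frobLog_logDerivOp_mem hW h3

/-- The logarithmic derivative of `V = ∫ log Y dlog q`. -/
theorem logDerivOp_dlogIntegral_logOf {m : ℤ} {Y : ℤ⟦X⟧} {u : (ℤ⸨X⸩)ˣ}
    (hY : constantCoeff Y = 1) (hu : (u : ℤ⸨X⸩) = HahnSeries.single m 1 * (Y : ℤ⸨X⸩)) :
    logDerivOp (dlogIntegral (logOf (PowerSeries.map (Int.castRingHom ℚ) Y))) = unitLog u := by
  have hY' : constantCoeff (PowerSeries.map (Int.castRingHom ℚ) Y) = 1 := by simp [hY]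
  rw [logDerivOp_dlogIntegral (constantCoeff_logOf hY'), logOf_eq_seriesLog hY', unitLog,
    (unit_decomposition_unique (by simp [hY]) hu).2]

/-! ### Orthogonality of explicit units -/

section Symbols

variable {A : Type*} [CommRing A]

theorem symbol_mul_right (f g h : Aˣ) : symbol f (g * h) = symbol f g + symbol f h := by
  simp only [symbol, ofMul_mul, TensorProduct.tmul_add, map_add]

theorem symbol_mul_left (f g h : Aˣ) : symbol (f * g) h = symbol f h + symbol g h := by
  simp only [symbol, ofMul_mul, TensorProduct.add_tmul, map_add]

theorem symbol_zpow_right (f g : Aˣ) (n : ℤ) : symbol f (g ^ n) = n • symbol f g :=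
  map_zsmul (AddMonoidHom.mk' (fun g : Additive Aˣ => symbol f g.toMul)
    fun a b => symbol_mul_right f a.toMul b.toMul) n (Additive.ofMul g)

theorem symbol_zpow_left (f g : Aˣ) (n : ℤ) : symbol (f ^ n) g = n • symbol f g :=
  map_zsmul (AddMonoidHom.mk' (fun f : Additive Aˣ => symbol f.toMul g)
    fun a b => symbol_mul_left a.toMul b.toMul g) n (Additive.ofMul f)

theorem symbol_eq_zero {f g : Aˣ} (h : (g : A) = 1 - f) : symbol f g = 0 := by
  rw [symbol, Submodule.mkQ_apply, Submodule.Quotient.mk_eq_zero]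
  exact Submodule.subset_span ⟨f, g, h, rfl⟩

/-- The units orthogonal to `f`. -/
def algOrthogonalSubgroup (f : Aˣ) : Subgroup Aˣ where
  carrier := {g | AlgOrthogonal f g}
  one_mem' := by
    have := symbol_zpow_right f 1 0
    rw [zpow_zero, zero_smul] at this
    simp [AlgOrthogonal, this]
  mul_mem' {a b} ha hb := by
    simp only [Set.mem_ofPred_eq, AlgOrthogonal, symbol_mul_right, smul_add] at *
    rw [ha, hb, add_zero]
  inv_mem' {a} ha := by
    simp only [Set.mem_ofPred_eq, AlgOrthogonal] at *
    rw [← zpow_neg_one, symbol_zpow_right, smul_comm, ha, smul_zero]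

/-- The exponent d moves to the left entry: d{f, 1 - f^d} = {f^d, 1 - f^d} = 0. -/
theorem algOrthogonal_zpow_of_one_sub {f g : Aˣ} (d : ℕ) (h : (g : A) = 1 - (f : A) ^ d) (n : ℤ) :
    AlgOrthogonal f (g ^ ((d : ℤ) * n)) := by
  have h1 : symbol (f ^ (d : ℤ)) g = 0 := symbol_eq_zero (by
    rw [h, zpow_natCast, Units.val_pow_eq_pow_val])
  rw [symbol_zpow_left] at h1
  rw [AlgOrthogonal, symbol_zpow_right, mul_comm, mul_smul, h1, smul_zero, smul_zero]

/-- From -f = (1 - f)/(1 - f⁻¹) one gets {f, -f} = 0. Then 2{f, f} = {f, (-f)²} = 0, which is why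
the factor 2 is needed. -/
theorem algOrthogonal_self {f g : Aˣ} (h : (g : A) = 1 - f) : AlgOrthogonal f f := by
  have h1 : symbol f⁻¹ (-f⁻¹ * g) = 0 := by
    apply symbol_eq_zero
    rw [Units.val_mul, h, Units.val_neg]
    linear_combination f.inv_mul
  rw [← zpow_neg_one f, symbol_zpow_left, neg_one_smul, neg_eq_zero, zpow_neg_one] at h1
  have h2 : symbol f g = symbol f (-f) + symbol f (-f⁻¹ * g) := by
    rw [← symbol_mul_right]; congr 1; simp
  rw [h1, add_zero, symbol_eq_zero h] at h2
  have h3 : symbol f (f ^ (2 : ℤ)) = symbol f ((-f) ^ (2 : ℤ)) := by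
    congr 1; rw [zpow_ofNat, zpow_ofNat, neg_sq]
  rw [symbol_zpow_right, symbol_zpow_right, ← h2, smul_zero] at h3
  exact h3

end Symbols

/-! ### Product expansions and convergence -/

/-- The unit `1 - q ^ (j + 1)` of `ℤ((q))`. -/
def oneSubUnit (j : ℕ) : (ℤ⸨X⸩)ˣ :=
  Units.map (HahnSeries.ofPowerSeries ℤ ℤ).toMonoidHom
    (isUnit_iff_constantCoeff.2 (by simp) : IsUnit (1 - X ^ (j + 1) : ℤ⟦X⟧)).unit

theorem oneSubUnit_eq_coe (j : ℕ) :
    (oneSubUnit j : ℤ⸨X⸩) = ((1 - X ^ (j + 1) : ℤ⟦X⟧) : ℤ⸨X⸩) := rfl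

theorem oneSubUnit_eq (j : ℕ) : (oneSubUnit j : ℤ⸨X⸩) = 1 - (qUnit : ℤ⸨X⸩) ^ (j + 1) := by
  rw [oneSubUnit_eq_coe]
  simp [qUnit]

theorem qUnit_zpow (m : ℤ) : ((qUnit ^ m : (ℤ⸨X⸩)ˣ) : ℤ⸨X⸩) = HahnSeries.single m 1 := by
  induction m using Int.induction_on with
  | zero => simp
  | succ i ih =>
    rw [zpow_add_one, Units.val_mul, ih]
    simp [qUnit]
  | pred i ih =>
    rw [zpow_sub_one, Units.val_mul, ih]
    simp [qUnit, sub_eq_add_neg]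

/-- The units of `ℤ((q))` which are power series with constant term `1`. -/
def principalUnits : Subgroup (ℤ⸨X⸩)ˣ where
  carrier := {f | unitOrd f = 0 ∧ constantCoeff (unitPart f) = 1}
  one_mem' := ⟨by simp [unitOrd], by simp [unitPart_one]⟩
  mul_mem' {a b} ha hb := by
    obtain ⟨h1, h2⟩ := unit_mul_decomposition a b
    exact ⟨by rw [h1, ha.1, hb.1, add_zero], by rw [h2, map_mul, ha.2, hb.2, mul_one]⟩
  inv_mem' {a} ha := by
    refine ⟨by rw [unitOrd_inv, ha.1, neg_zero], ?_⟩
    have h := congrArg constantCoeff (unit_mul_decomposition a a⁻¹).2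
    rw [mul_inv_cancel, unitPart_one, map_mul, ha.2, one_mul, map_one] at h
    exact h.symm

theorem mem_principalUnits {f : (ℤ⸨X⸩)ˣ} {u : ℤ⟦X⟧} (hu : constantCoeff u = 1)
    (h : (f : ℤ⸨X⸩) = (u : ℤ⸨X⸩)) : f ∈ principalUnits ∧ unitPart f = u := by
  obtain ⟨h1, h2⟩ := unit_decomposition_unique (f := f) (m := 0) (u := u) (by simp [hu])
    (by rw [h]; simp)
  exact ⟨⟨h1, by rw [h2, hu]⟩, h2⟩

/-- Follows from δu = δ(log u) · u. The constant term must be 1, as `unitLog` forgets the sign. -/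
theorem X_pow_dvd_unitPart_sub_one {f : (ℤ⸨X⸩)ˣ} (hf : f ∈ principalUnits) {N : ℕ}
    (h : X ^ N ∣ unitLog f) : X ^ N ∣ unitPart f - 1 := by
  have h1 : X ^ N ∣ PowerSeries.map (Int.castRingHom ℚ) (unitPart f - 1) := by
    apply X_pow_dvd_of_logDerivOp
    · simp [hf.2]
    · rw [map_sub, map_one, logDerivOp_sub, ← map_one C, logDerivOp_C, sub_zero,
        logDerivOp_seriesLog_mul (constantCoeff_map_ne_zero (isUnit_unitPart f))]
      exact (X_pow_dvd_logDerivOp h).mul_right _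
  rw [X_pow_dvd_iff] at h1 ⊢
  intro n hn
  have h2 := h1 n hn
  rw [coeff_map] at h2
  exact Int.cast_eq_zero.1 h2

theorem unitLog_oneSubUnit (j : ℕ) :
    unitLog (oneSubUnit j) = -expand (j + 1) j.succ_ne_zero (polylog 1) := by
  rw [unitLog, (mem_principalUnits (by simp) (oneSubUnit_eq_coe j)).2, map_sub, map_one, map_pow,
    map_X, seriesLog_one_sub (by simp), expand_apply]

/-- The finite products `q ^ m * ∏ (1 - q ^ d) ^ (-d * n d)`. -/
def productUnit (m : ℤ) (n : ℕ → ℤ) (N : ℕ) : (ℤ⸨X⸩)ˣ :=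
  qUnit ^ m * ∏ j ∈ Finset.range N, oneSubUnit j ^ (((j + 1 : ℕ) : ℤ) * -n (j + 1))

theorem algOrthogonal_productUnit (m : ℤ) (n : ℕ → ℤ) (N : ℕ) :
    AlgOrthogonal qUnit (productUnit m n N) := by
  refine (algOrthogonalSubgroup qUnit).mul_mem
    (zpow_mem (algOrthogonal_self (g := oneSubUnit 0) ?_) m) (prod_mem fun j _ =>
      algOrthogonal_zpow_of_one_sub (j + 1) (oneSubUnit_eq j) _)
  rw [oneSubUnit_eq, zero_add, pow_one]

/-- The exponents -d n_d fit because δ Li_2(q^d) = d Li_1(q^d) = -d log(1 - q^d). -/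
theorem unitLog_productUnit (m : ℤ) (n : ℕ → ℤ) (N : ℕ) :
    unitLog (productUnit m n N) = ∑ j ∈ Finset.range N,
      C ((n (j + 1) : ℤ) : ℚ) * logDerivOp (expand (j + 1) j.succ_ne_zero (polylog 2)) := by
  rw [← unitLogHom_apply, productUnit, ofMul_mul, map_add, ofMul_zpow, map_zsmul, unitLogHom_apply,
    unitLog_qUnit, smul_zero, zero_add, ofMul_prod, map_sum]
  refine Finset.sum_congr rfl fun j _ => ?_
  rw [ofMul_zpow, map_zsmul, unitLogHom_apply, unitLog_oneSubUnit, logDerivOp_expand,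
    logDerivOp_polylog_succ, ← Int.cast_smul_eq_zsmul ℚ, smul_eq_C_mul]
  push_cast
  simp only [map_mul, map_neg]
  ring

theorem tendsto_of_X_pow_dvd {u : (ℤ⸨X⸩)ˣ} {G : ℕ → (ℤ⸨X⸩)ˣ}
    (h : ∀ N, unitOrd (u⁻¹ * G N) = 0 ∧ X ^ N ∣ unitPart (u⁻¹ * G N) - 1) :
    Filter.Tendsto G Filter.atTop (@nhds _ (qAdicUnitsTopology ℤ) u) := by
  rw [tendsto_qAdicUnits_iff]
  intro K
  filter_upwards [Filter.eventually_ge_atTop (K - unitOrd u).toNat] with N hN k hk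
  obtain ⟨h0, w, hw⟩ := h N
  have h1 : (G N : ℤ⸨X⸩) - (u : ℤ⸨X⸩) =
      HahnSeries.single (unitOrd u + N) 1 * ((unitPart u * w : ℤ⟦X⟧) : ℤ⸨X⸩) := by
    have h2 := unit_eq_single_mul (u⁻¹ * G N)
    rw [h0, eq_add_of_sub_eq hw, show (HahnSeries.single (0 : ℤ) (1 : ℤ) : ℤ⸨X⸩) = 1 from rfl,
      one_mul, map_add, map_mul, map_one, HahnSeries.ofPowerSeries_X_pow] at h2
    have h3 : (G N : ℤ⸨X⸩) = u * ((u⁻¹ * G N : (ℤ⸨X⸩)ˣ) : ℤ⸨X⸩) := by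
      rw [← Units.val_mul, mul_inv_cancel_left]
    have h4 : (HahnSeries.single (unitOrd u + N) (1 : ℤ) : ℤ⸨X⸩) =
        HahnSeries.single (unitOrd u) 1 * HahnSeries.single (N : ℤ) 1 := by
      rw [HahnSeries.single_mul_single, one_mul]
    have h5 := unit_eq_single_mul u
    rw [h3, h2, h4, map_mul]
    linear_combination
      (HahnSeries.single (N : ℤ) 1 * HahnSeries.ofPowerSeries ℤ ℤ w : ℤ⸨X⸩) * h5
  rw [h1, coeff_single_mul_coe, if_pos (by omega)]

theorem orthogonal_of_isSFunction {m : ℤ} {Y : ℤ⟦X⟧} {u : (ℤ⸨X⸩)ˣ}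
    (hY : constantCoeff Y = 1) (hu : (u : ℤ⸨X⸩) = HahnSeries.single m 1 * (Y : ℤ⸨X⸩))
    {V : ℚ⟦X⟧} (hV : logDerivOp V = unitLog u) (h : IsSFunction 2 V) : Orthogonal qUnit u := by
  obtain ⟨n, hn⟩ := h
  refine ⟨fun _ => qUnit, productUnit m n, ?_, ?_, fun N => algOrthogonal_productUnit m n N⟩
  · exact tendsto_qAdicUnits_iff.2 fun N => Filter.Eventually.of_forall fun _ _ _ => by simp
  apply tendsto_of_X_pow_dvd
  intro N
  -- The powers of q cancel in u⁻¹ times the product, leaving a principal unit, for which closeness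
  -- of logarithms implies closeness of units.
  have hy : (qUnit ^ m)⁻¹ * u ∈ principalUnits := by
    refine (mem_principalUnits hY ?_).1
    rw [← zpow_neg, Units.val_mul, qUnit_zpow, hu, ← mul_assoc, HahnSeries.single_mul_single]
    simp
  have hmem : u⁻¹ * productUnit m n N ∈ principalUnits := by
    rw [productUnit, ← mul_assoc]
    refine mul_mem ?_ (prod_mem fun j _ => zpow_mem ?_ _)
    · simpa using inv_mem hy
    · exact (mem_principalUnits (by simp) (oneSubUnit_eq_coe j)).1
  refine ⟨hmem.1, X_pow_dvd_unitPart_sub_one hmem ?_⟩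
  rw [← unitLogHom_apply, ofMul_mul, map_add, ofMul_inv, map_neg, unitLogHom_apply,
    unitLogHom_apply, unitLog_productUnit, ← hV, X_pow_dvd_iff]
  -- For k < N the omitted terms, with d > N, start beyond degree k.
  intro k hk
  rw [map_add, map_neg, coeff_logDerivOp, hn.coeff_eq hk.le, map_sum, Finset.mul_sum,
    neg_add_eq_zero]
  refine Finset.sum_congr rfl fun i _ => ?_
  rw [coeff_C_mul, coeff_logDerivOp]
  ring

end TwoFunctions

end

open TwoFunctions in
theorem theorem2 :
    -- If `Y = exp (-δ W)` is an invertible element of `ℤ((q))` orthogonal to `q`, then `W` is a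
    -- 2-function for all odd primes.
    (∀ (W : ℚ⟦X⟧) (Y : (ℤ⸨X⸩)ˣ), PowerSeries.constantCoeff W = 0 →
      HahnSeries.map (Y : ℤ⸨X⸩) (Int.castRingHom ℚ) = (expNegLogDeriv W : ℚ⸨X⸩) →
      Orthogonal Y qUnit →
      ∀ p : ℕ, p.Prime → p ≠ 2 → IsSFunctionAt p 2 W) ∧
    -- The version for `q ^ m * Y`, where `Y` is an integral power series with constant term `1`,
    -- in terms of `∫ log Y dlog q`, with its converse.
    (∀ (m : ℤ) (Y : ℤ⟦X⟧) (u : (ℤ⸨X⸩)ˣ), PowerSeries.constantCoeff Y = 1 →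
      (u : ℤ⸨X⸩) = HahnSeries.single m 1 * (Y : ℤ⸨X⸩) →
      ∀ V : ℚ⟦X⟧, V = dlogIntegral (PowerSeries.logOf (PowerSeries.map (Int.castRingHom ℚ) Y)) →
        (Orthogonal qUnit u → ∀ p : ℕ, p.Prime → p ≠ 2 → IsSFunctionAt p 2 V) ∧
        (IsSFunction 2 V → Orthogonal qUnit u) ∧
        (IsSFunctionAt 2 2 V →
          (Orthogonal qUnit u ↔ ∀ p : ℕ, p.Prime → p ≠ 2 → IsSFunctionAt p 2 V))) := by
  refine ⟨fun W Y hW hY h p hp h2 => isSFunctionAt_of_expNegLogDeriv_orthogonal hW hY h hp h2, ?_⟩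
  rintro m Y u hY hu V rfl
  have hV := logDerivOp_dlogIntegral_logOf hY hu
  have hodd : Orthogonal qUnit u → ∀ p : ℕ, p.Prime → p ≠ 2 →
      IsSFunctionAt p 2
        (dlogIntegral (PowerSeries.logOf (PowerSeries.map (Int.castRingHom ℚ) Y))) := by
    intro h p hp h2
    have : Fact p.Prime := ⟨hp⟩
    exact isSFunctionAt_of_frobLog_logDerivOp_mem (constantCoeff_dlogIntegral _)
      (hV ▸ frobLog_unitLog_mem_of_orthogonal_qUnit h2 (Or.inr h))
  refine ⟨hodd, orthogonal_of_isSFunction hY hu hV, fun h2 => ⟨hodd, fun h => ?_⟩⟩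
  refine orthogonal_of_isSFunction hY hu hV (isSFunction_of_forall_prime fun p hp => ?_)
  -- Integrality at 2 comes from the separate hypothesis; the regulator argument covers only odd
  -- primes.
  by_cases hp2 : p = 2
  · exact hp2 ▸ h2
  · exact h p hp hp2
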